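/- A rearrangement-invariant (r.i.) space on $[0,1]$ is a Banach space $(E,\|\cdot\|_E)$ of real-valued measurable functions on $[0,1]$ (identified when equal almost everywhere with respect to Lebesgue measure $m$) such that (i) if $y\in E$ and $x$ is measurable with $|x|\le |y|$ a.e., then $x\in E$ and $\|x\|_E\le\|y\|_E$; (ii) if $y\in E$ and $x$ is measurable with $x^*=y^*$, then $x\in E$ and $\|x\|_E=\|y\|_E$, where $x^*(t)=\inf\{s\ge 0: m(\{u\in[0,1]:|x(u)|>s\})\le t\}$ for $t>0$. $E$ has the Fatou property if, whenever $f_n\in E$ and $f$ is measurable with $f_n\to f$ a.e. and $\sup_n\|f_n\|_E<\infty$, one has $f\in E$ and $\|f\|_E\le\liminf_{n}\|f_n\|_E$. For $p\ge 1$, a bounded sequence $\{x_n\}\subset E$ is called a $p$-BS-sequence if every subsequence $\{y_k\}$ of $\{x_n\}$ satisfies $\sup_{m\ge1} m^{-1/p}\big\|\sum_{k=1}^m y_k\big\|_E<\infty$. Let $\Gamma_{\rm i}(E)$ (respectively $\Gamma_{\rm iid}(E)$, $\Gamma_{\rm d}(E)$) denote the set of all real $p\ge1$ such that each weakly null sequence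 in $E$ consisting of independent random variables on $([0,1],m)$ (respectively, of independent identically distributed random variables, of pairwise disjointly supported functions) has a subsequence that is a $p$-BS-sequence. Theorem. For every separable r.i. space $E$ on $[0,1]$ with the Fatou property, $$\Gamma_{\rm iid}(E)=\Gamma_{\rm i}(E)\iff \Gamma_{\rm iid}(E)\subseteq\Gamma_{\rm d}(E).$$ -/

import Mathlib

open Filter Topology MeasureTheory ProbabilityTheory unitInterval

noncomputable section

/-- The space of (classes modulo equality almost everywhere of) real-valued measurable functions
on `[0,1]` with Lebesgue measure. -/
abbrev L0 : Type := I →ₘ[(volume : Measure I)] ℝ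

/-- The non-increasing right-continuous rearrangement
`x^*(t) = inf {s ≥ 0 : m {u ∈ [0,1] : |x u| > s} ≤ t}`, for `t > 0`. -/
def rearrangement (x : L0) (t : ℝ) : ℝ :=
  sInf {s : ℝ | 0 ≤ s ∧ (volume : Measure I) {u : I | s < |x u|} ≤ ENNReal.ofReal t}

/-- A rearrangement-invariant Banach function space on `[0,1]`. -/
structure RISpace where
  /-- the functions that belong to the space -/
  carrier : Submodule ℝ L0
  /-- the norm -/
  toNorm : Norm carrier
  /-- the norm axioms -/
  core : NormedSpace.Core ℝ carrier
  /-- completeness in the norm -/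
  complete : letI : NormedAddCommGroup carrier := NormedAddCommGroup.ofCore core
    CompleteSpace carrier
  /-- the space is an ideal lattice -/
  ideal : ∀ (y : carrier) (x : L0), (∀ᵐ t : I, |x t| ≤ |(y : L0) t|) →
    ∃ hx : x ∈ carrier, toNorm.norm ⟨x, hx⟩ ≤ toNorm.norm y
  /-- the space is rearrangement invariant -/
  rearr : ∀ (y : carrier) (x : L0),
    (∀ t : ℝ, 0 < t → rearrangement x t = rearrangement (y : L0) t) →
    ∃ hx : x ∈ carrier, toNorm.norm ⟨x, hx⟩ = toNorm.norm y

namespace RISpace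

instance (E : RISpace) : Norm E.carrier := E.toNorm

instance (E : RISpace) : NormedAddCommGroup E.carrier := NormedAddCommGroup.ofCore E.core

instance (E : RISpace) : NormedSpace ℝ E.carrier := NormedSpace.ofCore E.core

instance (E : RISpace) : CompleteSpace E.carrier := E.complete

/-- The Fatou property. -/
def FatouProperty (E : RISpace) : Prop :=
  ∀ (f : ℕ → E.carrier) (g : L0),
    (∀ᵐ t : I, Tendsto (fun n => (f n : L0) t) atTop (𝓝 (g t))) →
    BddAbove (Set.range fun n => ‖f n‖) →
    ∃ hg : g ∈ E.carrier, ‖(⟨g, hg⟩ : E.carrier)‖ ≤ liminf (fun n => ‖f n‖) atTop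

/-- Weak convergence to zero in the Banach space `E`. -/
def WeaklyNull (E : RISpace) (x : ℕ → E.carrier) : Prop :=
  ∀ F : StrongDual ℝ E.carrier, Tendsto (fun n => F (x n)) atTop (𝓝 0)

/-- `x` is a `p`-BS-sequence: it is bounded, and for each of its subsequences `y` one has
`sup_m m^(-1/p) ‖y_1 + ⋯ + y_m‖ < ∞`. -/
def IsBSSeq (E : RISpace) (p : ℝ) (x : ℕ → E.carrier) : Prop :=
  BddAbove (Set.range fun n => ‖x n‖) ∧
  ∀ φ : ℕ → ℕ, StrictMono φ →
    ∃ C : ℝ, ∀ m : ℕ, 1 ≤ m →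
      (m : ℝ) ^ (-(1 / p)) * ‖∑ k ∈ Finset.range m, x (φ k)‖ ≤ C

/-- The set of all `p ≥ 1` such that each weakly null sequence in `E` with the property `P`
contains a `p`-BS-sequence. -/
def bsIndexSet (E : RISpace) (P : (ℕ → E.carrier) → Prop) : Set ℝ :=
  {p : ℝ | 1 ≤ p ∧ ∀ x : ℕ → E.carrier, E.WeaklyNull x → P x →
    ∃ φ : ℕ → ℕ, StrictMono φ ∧ E.IsBSSeq p (x ∘ φ)}

/-- The terms of the sequence are (mutually) independent random variables on `[0,1]`. -/
def Independent (E : RISpace) (x : ℕ → E.carrier) : Prop :=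
  iIndepFun (fun (n : ℕ) (t : I) => (x n : L0) t) (volume : Measure I)

/-- The terms of the sequence are identically distributed. -/
def IdenticallyDistributed (E : RISpace) (x : ℕ → E.carrier) : Prop :=
  ∀ m n : ℕ, IdentDistrib (fun t : I => (x m : L0) t) (fun t : I => (x n : L0) t)
    (volume : Measure I) (volume : Measure I)

/-- The terms of the sequence are pairwise disjoint. -/
def PairwiseDisjoint (E : RISpace) (x : ℕ → E.carrier) : Prop :=
  ∀ m n : ℕ, m ≠ n → ∀ᵐ t : I, (x m : L0) t = 0 ∨ (x n : L0) t = 0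

/-- `Γ_i(E)` -/
def Γi (E : RISpace) : Set ℝ := E.bsIndexSet E.Independent

/-- `Γ_iid(E)` -/
def Γiid (E : RISpace) : Set ℝ :=
  E.bsIndexSet fun x => E.Independent x ∧ E.IdenticallyDistributed x

/-- `Γ_d(E)` -/
def Γd (E : RISpace) : Set ℝ := E.bsIndexSet E.PairwiseDisjoint

end RISpace

end

/-! Since iid sequences are independent, `Γi ⊆ Γiid` is immediate. It remains to prove `Γi ⊆ Γd`
always, and `Γiid ⊆ Γi` under the assumption `Γiid ⊆ Γd`. In both, separability and the Fatou
property enter through absolute continuity of the norm (`exists_norm_restrict_lt`): truncating on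
small sets costs little.

`Γi ⊆ Γd`: a disjoint weakly null sequence is replaced by independent copies of its terms. The
supports have measures tending to zero, so along a subsequence each copy is small in norm on the
union of the later supports. Removing that union leaves a disjoint sequence whose distribution
functions are those of the original terms multiplied by factors in `[1/2, 1]`. Such disjoint
sequences dominate each other in norm with constants 1 and 2, so both weak nullness and the BS
property can be transferred.

`Γiid ⊆ Γi`: the behaviour of an independent sequence depends only on its joint law, so its terms
may be realised as quantile functions composed with independent uniform maps `U n`. By Helly's
theorem the quantile functions converge a.e. along a subsequence to some `q` in `E`. The centred
limit composed with the same `U n` is an iid sequence, weakly null by the strong law of large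
numbers, and is handled by `p ∈ Γiid`. The remainder tends to zero in measure up to the constant
mean of `q`; weak nullness forces this constant to vanish, and the remainder is then almost disjoint
along a subsequence, so `p ∈ Γd` applies. -/

noncomputable section

/-! ### Quantile functions as realisations of laws on `[0,1]` -/

/-- The quantile function of a probability measure on the line, extended by `0` outside `(0,1)`. -/
def quantile (ν : Measure ℝ) (t : ℝ) : ℝ :=
  if t ∈ Set.Ioo (0 : ℝ) 1 then sInf {s : ℝ | t ≤ cdf ν s} else 0

/-- Right continuity of the cdf makes the infimum attained. The set is nonempty because `t < 1` and
bounded below because `0 < t`. -/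
lemma quantile_le_iff (ν : Measure ℝ) {t : ℝ} (ht : t ∈ Set.Ioo (0 : ℝ) 1) (s : ℝ) :
    quantile ν t ≤ s ↔ t ≤ cdf ν s := by
  rw [quantile, if_pos ht]
  have hne : {s : ℝ | t ≤ cdf ν s}.Nonempty := by
    obtain ⟨s, hs⟩ := ((tendsto_order.1 (tendsto_cdf_atTop ν)).1 t ht.2).exists
    exact ⟨s, hs.le⟩
  have hbdd : BddBelow {s : ℝ | t ≤ cdf ν s} := by
    obtain ⟨b, hb⟩ := ((tendsto_order.1 (tendsto_cdf_atBot ν)).2 t ht.1).exists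
    refine ⟨b, fun s hs => ?_⟩
    by_contra! h
    exact absurd (monotone_cdf ν h.le) (not_le.2 (hb.trans_le hs))
  constructor
  · intro h
    refine ge_of_tendsto (f := cdf ν) (x := 𝓝[>] s) (((cdf ν).right_continuous s).mono_left
      (nhdsWithin_mono _ Set.Ioi_subset_Ici_self)) ?_
    filter_upwards [self_mem_nhdsWithin] with r hr
    obtain ⟨q, hq, hqr⟩ := exists_lt_of_csInf_lt hne (h.trans_lt hr)
    exact le_trans hq (monotone_cdf ν hqr.le)
  · intro h
    exact csInf_le hbdd h

lemma quantile_monotoneOn (ν : Measure ℝ) : MonotoneOn (quantile ν) (Set.Ioo 0 1) := by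
  intro a ha b hb hab
  rw [quantile_le_iff ν ha]
  exact hab.trans ((quantile_le_iff ν hb _).1 le_rfl)

@[fun_prop]
lemma measurable_quantile (ν : Measure ℝ) : Measurable (quantile ν) := by
  refine measurable_of_Iic fun s => ?_
  have : quantile ν ⁻¹' Set.Iic s
      = (Set.Ioo 0 1 ∩ Set.Iic (cdf ν s)) ∪ ((Set.Ioo 0 1)ᶜ ∩ {_t : ℝ | (0 : ℝ) ≤ s}) := by
    ext t
    by_cases ht : t ∈ Set.Ioo (0 : ℝ) 1
    · simpa [ht] using quantile_le_iff ν ht s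
    · simp only [Set.mem_preimage, Set.mem_Iic, quantile, if_neg ht]
      simp [ht]
  rw [this]
  exact (measurableSet_Ioo.inter measurableSet_Iic).union
    (measurableSet_Ioo.compl.inter (MeasurableSet.const _))

lemma ae_mem_Ioo : ∀ᵐ t : I, (t : ℝ) ∈ Set.Ioo (0 : ℝ) 1 := by
  have h0 : ∀ᵐ t : I, t ≠ 0 := by simp [ae_iff]
  have h1 : ∀ᵐ t : I, t ≠ 1 := by simp [ae_iff]
  filter_upwards [h0, h1] with t h0 h1
  exact ⟨unitInterval.pos_iff_ne_zero.2 h0, unitInterval.lt_one_iff_ne_one.2 h1⟩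

/-- Inverse transform sampling: by `quantile_le_iff` the preimage of `Iic s` is, up to endpoints,
the interval `[0, cdf ν s]`. -/
lemma map_quantile (ν : Measure ℝ) [IsProbabilityMeasure ν] :
    (volume : Measure I).map (fun t : I => quantile ν t) = ν := by
  have hm : Measurable (fun t : I => quantile ν t) := by fun_prop
  have := Measure.isProbabilityMeasure_map (μ := (volume : Measure I)) hm.aemeasurable
  refine Measure.ext_of_Iic _ _ fun s => ?_
  rw [Measure.map_apply hm measurableSet_Iic]
  have hs : cdf ν s ∈ Set.Icc (0 : ℝ) 1 := ⟨cdf_nonneg ν s, cdf_le_one ν s⟩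
  have : (fun t : I => quantile ν t) ⁻¹' Set.Iic s =ᵐ[volume] Set.Iic (⟨cdf ν s, hs⟩ : I) := by
    filter_upwards [ae_mem_Ioo] with t ht
    exact propext (quantile_le_iff ν ht s)
  rw [measure_congr this, unitInterval.volume_Iic, ofReal_cdf]

lemma quantile_le_quantile {μ ν : Measure ℝ} (h : ∀ s, cdf ν s ≤ cdf μ s) {t : ℝ}
    (ht : t ∈ Set.Ioo (0 : ℝ) 1) : quantile μ t ≤ quantile ν t := by
  rw [quantile_le_iff μ ht]
  exact ((quantile_le_iff ν ht _).1 le_rfl).trans (h _)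

lemma rearrangement_congr {x y : L0}
    (h : ∀ s : ℝ, 0 ≤ s → (volume : Measure I) {u | s < |x u|} = volume {u | s < |y u|}) (t : ℝ) :
    rearrangement x t = rearrangement y t := by
  unfold rearrangement
  congr 1
  ext s
  constructor
  · rintro ⟨hs, h1⟩
    exact ⟨hs, by rwa [← h s hs]⟩
  · rintro ⟨hs, h1⟩
    exact ⟨hs, by rwa [h s hs]⟩

/-! ### Comparison of norms through distribution functions -/

namespace RISpace

variable {E : RISpace}

/-- The distribution function of `|x|`. -/
def distr (x : I → ℝ) (s : ℝ) : ENNReal := volume {u : I | s < |x u|}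

lemma distr_congr {x y : I → ℝ} (h : x =ᵐ[volume] y) (s : ℝ) : distr x s = distr y s := by
  refine measure_congr ?_
  filter_upwards [h] with t ht
  exact propext (by change s < |x t| ↔ s < |y t|; rw [ht])

lemma distr_eq_of_identDistrib {x y : I → ℝ} (h : IdentDistrib x y volume volume) (s : ℝ) :
    distr x s = distr y s :=
  h.measure_mem_eq (s := {r : ℝ | s < |r|}) (measurableSet_lt measurable_const (by fun_prop))

/-- Recasts the rearrangement axiom in terms of distribution functions, the form in which it is used
from here on. -/
lemma norm_eq_of_distr (y : E.carrier) (x : L0)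
    (h : ∀ s : ℝ, 0 ≤ s → distr x s = distr (y : L0) s) :
    ∃ hx : x ∈ E.carrier, ‖(⟨x, hx⟩ : E.carrier)‖ = ‖y‖ :=
  E.rearr y x fun t _ => rearrangement_congr h t

lemma norm_le_of_ae_le (y : E.carrier) (x : L0) (h : ∀ᵐ t : I, |x t| ≤ |(y : L0) t|) :
    ∃ hx : x ∈ E.carrier, ‖(⟨x, hx⟩ : E.carrier)‖ ≤ ‖y‖ :=
  E.ideal y x h

/-- The non-decreasing rearrangement of `|x|`. -/
def star (x : L0) : L0 :=
  AEEqFun.mk (fun t : I => quantile ((volume : Measure I).map fun t => |x t|) t)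
    (by fun_prop : Measurable _).aestronglyMeasurable

lemma coeFn_star (x : L0) : star x =ᵐ[volume]
    fun t : I => quantile ((volume : Measure I).map fun t => |x t|) t :=
  AEEqFun.coeFn_mk _ _

lemma aemeasurable_abs (x : L0) : AEMeasurable (fun t => |x t|) (volume : Measure I) :=
  (continuous_abs.measurable.comp x.measurable).aemeasurable

lemma identDistrib_star (x : L0) :
    IdentDistrib (star x) (fun t => |x t|) (volume : Measure I) volume := by
  have := Measure.isProbabilityMeasure_map (aemeasurable_abs x)
  refine ⟨(star x).measurable.aemeasurable, aemeasurable_abs x, ?_⟩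
  rw [Measure.map_congr (coeFn_star x), map_quantile]

lemma distr_star (x : L0) (s : ℝ) : distr (star x) s = distr x s := by
  rw [distr_eq_of_identDistrib (identDistrib_star x)]
  simp [distr]

/-- Domination of the distribution functions implies domination of the norms. -/
theorem norm_le_of_distr (y : E.carrier) (x : L0)
    (h : ∀ s : ℝ, 0 ≤ s → distr x s ≤ distr (y : L0) s) :
    ∃ hx : x ∈ E.carrier, ‖(⟨x, hx⟩ : E.carrier)‖ ≤ ‖y‖ := by
  have hcompl : ∀ (z : L0) (s : ℝ), 0 ≤ s →
      cdf ((volume : Measure I).map fun t => |z t|) s = 1 - (distr z s).toReal := by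
    intro z s _
    have := Measure.isProbabilityMeasure_map (aemeasurable_abs z)
    have hms : MeasurableSet {u : I | s < |z u|} :=
      measurableSet_lt measurable_const (continuous_abs.measurable.comp z.measurable)
    rw [ProbabilityTheory.cdf_eq_real, Measure.real, Measure.map_apply_of_aemeasurable (aemeasurable_abs z)
      measurableSet_Iic, distr]
    change _ = 1 - (volume : Measure I).real _
    rw [← probReal_compl_eq_one_sub hms, Measure.real]
    congr 2
    ext t
    simp
  have hneg : ∀ (z : L0) (s : ℝ), s < 0 →
      cdf ((volume : Measure I).map fun t => |z t|) s = 0 := by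
    intro z s hs
    have := Measure.isProbabilityMeasure_map (aemeasurable_abs z)
    rw [ProbabilityTheory.cdf_eq_real, Measure.real, Measure.map_apply_of_aemeasurable (aemeasurable_abs z)
      measurableSet_Iic]
    have : (fun t => |z t|) ⁻¹' Set.Iic s = ∅ := by
      ext t
      simpa using hs.trans_le (abs_nonneg _)
    simp [this]
  have hle : ∀ s, cdf ((volume : Measure I).map fun t => |(y : L0) t|) s
      ≤ cdf ((volume : Measure I).map fun t => |x t|) s := by
    intro s
    rcases lt_or_ge s 0 with hs | hs
    · rw [hneg _ _ hs, hneg _ _ hs]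
    · rw [hcompl _ _ hs, hcompl _ _ hs]
      exact sub_le_sub_left (ENNReal.toReal_mono (measure_ne_top _ _) (h s hs)) _
  -- After monotone rearrangement of both functions, domination of distributions becomes pointwise
  -- domination, and the ideal property applies.
  obtain ⟨hY, hYn⟩ := norm_eq_of_distr y (star y) fun s _ => distr_star _ s
  obtain ⟨hX, hXn⟩ := norm_le_of_ae_le ⟨star y, hY⟩ (star x) (by
    filter_upwards [coeFn_star x, coeFn_star y, ae_mem_Ioo] with t h1 h2 ht
    rw [h1, h2]
    have h0 : 0 ≤ quantile ((volume : Measure I).map fun t => |x t|) t := by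
      by_contra! h0
      have := (quantile_le_iff ((volume : Measure I).map fun t => |x t|) ht _).1 le_rfl
      rw [hneg _ _ h0] at this
      exact absurd ht.1 (not_lt.2 this)
    exact abs_le_abs_of_nonneg h0 (quantile_le_quantile hle ht))
  obtain ⟨hx, hxn⟩ := norm_eq_of_distr (⟨star x, hX⟩ : E.carrier) x fun s _ => (distr_star _ s).symm
  exact ⟨hx, by rw [hxn]; exact hXn.trans hYn.le⟩

end RISpace

/-! ### Independent copies -/

/-- There is a sequence of independent uniformly distributed maps of the unit interval. -/
lemma exists_iid_uniform : ∃ U : ℕ → I → I,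
    (∀ n, MeasurePreserving (U n) volume volume) ∧ iIndepFun U (volume : Measure I) := by
  -- Lebesgue measure on `[0,1]` can be pushed to the infinite product of copies of itself; the
  -- coordinates of such a map are the `U n`.
  obtain ⟨f, hf, hmap⟩ := Measure.exists_measurable_map_eq
    (Measure.infinitePi fun _ : ℕ => (volume : Measure I))
  have hU : ∀ n, MeasurePreserving (fun t => f t n) (volume : Measure I) volume := fun n => by
    refine ⟨by fun_prop, ?_⟩
    have : (fun t => f t n) = Function.eval n ∘ f := rfl
    rw [this, ← Measure.map_map (by fun_prop) hf, hmap, Measure.infinitePi_map_eval]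
  refine ⟨fun n t => f t n, hU, ?_⟩
  rw [iIndepFun_iff_map_fun_eq_infinitePi_map fun n => (hU n).measurable]
  simp only [(hU _).map_eq]
  exact hmap

lemma identDistrib_comp {g : I → ℝ} (hg : Measurable g) {T : I → I}
    (hT : MeasurePreserving T volume volume) :
    IdentDistrib (fun t => g (T t)) g (volume : Measure I) volume := by
  refine ⟨(hg.comp hT.measurable).aemeasurable, hg.aemeasurable, ?_⟩
  conv_rhs => rw [← hT.map_eq, Measure.map_map hg hT.measurable]
  rfl

namespace RISpace

variable {E : RISpace}

lemma exists_mem_of_distr_le (y : E.carrier) (g : I → ℝ) (hg : AEMeasurable g volume)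
    (h : ∀ s : ℝ, 0 ≤ s → distr g s ≤ distr (y : L0) s) :
    ∃ z : E.carrier, (z : L0) =ᵐ[volume] g ∧ ‖z‖ ≤ ‖y‖ := by
  have hc := AEEqFun.coeFn_mk g hg.aestronglyMeasurable
  obtain ⟨hx, hn⟩ := norm_le_of_distr y (AEEqFun.mk g hg.aestronglyMeasurable) fun s hs => by
    rw [distr_congr hc]
    exact h s hs
  exact ⟨⟨_, hx⟩, hc, hn⟩

lemma norm_le_of_distr_le (x y : E.carrier)
    (h : ∀ s : ℝ, 0 ≤ s → distr (x : L0) s ≤ distr (y : L0) s) : ‖x‖ ≤ ‖y‖ :=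
  (norm_le_of_distr y x h).2

lemma norm_eq_of_identDistrib (x y : E.carrier)
    (h : IdentDistrib (x : L0) (y : L0) volume volume) : ‖x‖ = ‖y‖ :=
  le_antisymm (norm_le_of_distr_le _ _ fun s _ => (distr_eq_of_identDistrib h s).le)
    (norm_le_of_distr_le _ _ fun s _ => (distr_eq_of_identDistrib h s).ge)

lemma exists_mem_of_identDistrib (y : E.carrier) (g : I → ℝ)
    (h : IdentDistrib g (y : L0) volume volume) :
    ∃ z : E.carrier, (z : L0) =ᵐ[volume] g ∧ ‖z‖ = ‖y‖ := by
  obtain ⟨z, hz, -⟩ := exists_mem_of_distr_le y g h.aemeasurable_fst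
    fun s _ => (distr_eq_of_identDistrib h s).le
  exact ⟨z, hz, norm_eq_of_identDistrib _ _
    ((IdentDistrib.of_ae_eq (z : L0).measurable.aemeasurable hz).trans h)⟩

lemma norm_le_of_abs_le (x y : E.carrier) (h : ∀ᵐ t : I, |(x : L0) t| ≤ |(y : L0) t|) :
    ‖x‖ ≤ ‖y‖ :=
  (norm_le_of_ae_le y x h).2

lemma ext_ae {x y : E.carrier} (h : (x : L0) =ᵐ[volume] (y : L0)) : x = y :=
  Subtype.ext (AEEqFun.ext h)

lemma coeFn_add (x y : E.carrier) :
    ((x + y : E.carrier) : L0) =ᵐ[volume] fun t => (x : L0) t + (y : L0) t :=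
  AEEqFun.coeFn_add _ _

lemma coeFn_sub (x y : E.carrier) :
    ((x - y : E.carrier) : L0) =ᵐ[volume] fun t => (x : L0) t - (y : L0) t :=
  AEEqFun.coeFn_sub _ _

lemma coeFn_smul (c : ℝ) (x : E.carrier) :
    ((c • x : E.carrier) : L0) =ᵐ[volume] fun t => c * (x : L0) t :=
  AEEqFun.coeFn_smul _ _

lemma coeFn_zero : ((0 : E.carrier) : L0) =ᵐ[volume] fun _ => (0 : ℝ) :=
  AEEqFun.coeFn_zero

lemma coeFn_sum {ι : Type*} (s : Finset ι) (x : ι → E.carrier) :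
    ((∑ i ∈ s, x i : E.carrier) : L0) =ᵐ[volume] fun t => ∑ i ∈ s, (x i : L0) t := by
  classical
  induction s using Finset.induction_on with
  | empty => simpa using coeFn_zero (E := E)
  | insert a s ha ih =>
    rw [Finset.sum_insert ha]
    filter_upwards [coeFn_add (x a) (∑ i ∈ s, x i), ih] with t h1 h2
    rw [h1, h2, Finset.sum_insert ha]

/-! ### Restriction to measurable sets and dilation -/

/-- Multiplication by the indicator function of a measurable set. -/
def restrict (A : Set I) (hA : MeasurableSet A) : E.carrier →L[ℝ] E.carrier :=
  let χ : L0 := AEEqFun.mk (A.indicator 1)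
    ((measurable_const.indicator hA : Measurable (A.indicator (fun _ => (1 : ℝ)))).aestronglyMeasurable)
  have hχ : ∀ f : E.carrier, ∀ᵐ t : I, |(χ * (f : L0)) t| ≤ |(f : L0) t| := fun f => by
    filter_upwards [AEEqFun.coeFn_mul χ (f : L0), AEEqFun.coeFn_mk (A.indicator (1 : I → ℝ))
      ((measurable_const.indicator hA : Measurable
        (A.indicator (fun _ => (1 : ℝ)))).aestronglyMeasurable)] with t h1 h2
    rw [h1, Pi.mul_apply, h2]
    by_cases ht : t ∈ A <;> simp [ht]
  LinearMap.mkContinuous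
    { toFun := fun f => ⟨χ * (f : L0), (norm_le_of_ae_le f _ (hχ f)).1⟩
      map_add' := fun f g => Subtype.ext <| AEEqFun.ext <| by
        filter_upwards [AEEqFun.coeFn_mul χ ((f + g : E.carrier) : L0), coeFn_add f g,
          AEEqFun.coeFn_mul χ (f : L0), AEEqFun.coeFn_mul χ (g : L0),
          AEEqFun.coeFn_add (χ * (f : L0)) (χ * (g : L0))] with t h1 h2 h3 h4 h5
        change (χ * ((f + g : E.carrier) : L0)) t = (χ * (f : L0) + χ * (g : L0)) t
        rw [h1, h5, Pi.mul_apply, Pi.add_apply, h2, h3, h4, Pi.mul_apply, Pi.mul_apply, mul_add]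
      map_smul' := fun c f => Subtype.ext <| AEEqFun.ext <| by
        filter_upwards [AEEqFun.coeFn_mul χ ((c • f : E.carrier) : L0), coeFn_smul c f,
          AEEqFun.coeFn_mul χ (f : L0), AEEqFun.coeFn_smul c (χ * (f : L0))] with t h1 h2 h3 h5
        change (χ * ((c • f : E.carrier) : L0)) t = (c • (χ * (f : L0))) t
        rw [h1, h5, Pi.mul_apply, Pi.smul_apply, h2, h3, Pi.mul_apply, smul_eq_mul,
          mul_left_comm] } 1
    fun f => by simpa using (norm_le_of_ae_le f _ (hχ f)).2

lemma coeFn_restrict (A : Set I) (hA : MeasurableSet A) (f : E.carrier) :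
    (restrict A hA f : L0) =ᵐ[volume] A.indicator (f : L0) := by
  have hm : AEStronglyMeasurable (A.indicator (1 : I → ℝ)) volume :=
    (measurable_const.indicator hA : Measurable
        (A.indicator (fun _ => (1 : ℝ)))).aestronglyMeasurable
  filter_upwards [AEEqFun.coeFn_mul (AEEqFun.mk _ hm) (f : L0), AEEqFun.coeFn_mk _ hm] with t h1 h2
  change (AEEqFun.mk _ hm * (f : L0)) t = _
  rw [h1, Pi.mul_apply, h2]
  by_cases ht : t ∈ A <;> simp [ht]

lemma norm_restrict_le (A : Set I) (hA : MeasurableSet A) (f : E.carrier) :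
    ‖restrict A hA f‖ ≤ ‖f‖ := by
  refine norm_le_of_abs_le _ _ ?_
  filter_upwards [coeFn_restrict A hA f] with t ht
  rw [ht]
  by_cases h : t ∈ A <;> simp [h]

lemma norm_restrict_mono {A B : Set I} (hA : MeasurableSet A) (hB : MeasurableSet B) (h : A ⊆ B)
    (f : E.carrier) : ‖restrict A hA f‖ ≤ ‖restrict B hB f‖ := by
  refine norm_le_of_abs_le _ _ ?_
  filter_upwards [coeFn_restrict A hA f, coeFn_restrict B hB f] with t h1 h2
  rw [h1, h2]
  by_cases h' : t ∈ A
  · simp [h', h h']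
  · simp [h']

lemma restrict_restrict {A B : Set I} (hA : MeasurableSet A) (hB : MeasurableSet B)
    (f : E.carrier) : restrict A hA (restrict B hB f) = restrict (A ∩ B) (hA.inter hB) f := by
  refine ext_ae ?_
  filter_upwards [coeFn_restrict A hA (restrict B hB f), coeFn_restrict B hB f,
    coeFn_restrict (A ∩ B) (hA.inter hB) f] with t h1 h2 h3
  rw [h1, h3, ← Set.indicator_indicator]
  by_cases h : t ∈ A <;> simp [h, h2]

lemma restrict_congr {A B : Set I} (hA : MeasurableSet A) (hB : MeasurableSet B) (h : A = B)
    (f : E.carrier) : restrict A hA f = restrict B hB f := by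
  subst h; rfl

lemma restrict_add_compl {A : Set I} (hA : MeasurableSet A) (f : E.carrier) :
    restrict A hA f + restrict Aᶜ hA.compl f = f := by
  refine ext_ae ?_
  filter_upwards [coeFn_add (restrict A hA f) (restrict Aᶜ hA.compl f), coeFn_restrict A hA f,
    coeFn_restrict Aᶜ hA.compl f] with t h1 h2 h3
  rw [h1, h2, h3]
  by_cases h : t ∈ A <;> simp [h]

/-- The dilation by `2` has norm at most `2`. -/
theorem norm_le_two_mul_of_distr_le (x y : E.carrier)
    (h : ∀ s : ℝ, 0 ≤ s → distr (x : L0) s ≤ 2 * distr (y : L0) s) : ‖x‖ ≤ 2 * ‖y‖ := by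
  obtain ⟨U, hU, hind⟩ := exists_iid_uniform
  have hxm : Measurable (x : L0) := (x : L0).measurable
  obtain ⟨z, hz, hzn⟩ := exists_mem_of_identDistrib x (fun t => (x : L0) (U 0 t))
    (identDistrib_comp hxm (hU 0))
  -- The copy `x ∘ U 0` is independent of `U 1`, so restricting it to an event of probability 1/2 in
  -- `U 1` halves its distribution function, which then lies below that of `y`. Two complementary
  -- events give the factor 2.
  have key : ∀ (B : Set I) (hB : MeasurableSet B), volume B = 2⁻¹ →
      ‖restrict (U 1 ⁻¹' B) ((hU 1).measurable hB) z‖ ≤ ‖y‖ := by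
    intro B hB hvol
    refine norm_le_of_distr_le _ _ fun s hs => ?_
    have h1 : distr (restrict (U 1 ⁻¹' B) ((hU 1).measurable hB) z : L0) s
        = volume (U 0 ⁻¹' {t | s < |(x : L0) t|} ∩ U 1 ⁻¹' B) := by
      refine measure_congr ?_
      filter_upwards [coeFn_restrict (U 1 ⁻¹' B) ((hU 1).measurable hB) z, hz] with t h1 h2
      refine propext ?_
      change s < |_| ↔ (s < |(x : L0) (U 0 t)| ∧ t ∈ U 1 ⁻¹' B)
      rw [h1]
      by_cases h' : t ∈ U 1 ⁻¹' B
      · simp [h', h2]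
      · simp [h', hs]
    have hms : MeasurableSet {t | s < |(x : L0) t|} :=
      measurableSet_lt measurable_const (continuous_abs.measurable.comp hxm)
    rw [h1, (hind.indepFun zero_ne_one).measure_inter_preimage_eq_mul _ _ hms hB,
      (hU 0).measure_preimage hms.nullMeasurableSet, (hU 1).measure_preimage hB.nullMeasurableSet,
      hvol, ← div_eq_mul_inv]
    refine ENNReal.div_le_of_le_mul ?_
    rw [mul_comm]
    exact h s hs
  have hhalf : ((1 : ℝ) / 2) ∈ I := ⟨by norm_num, by norm_num⟩
  have hv : volume (Set.Iic (⟨1 / 2, hhalf⟩ : I)) = 2⁻¹ := by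
    rw [unitInterval.volume_Iic]
    simp [ENNReal.ofReal_inv_of_pos]
  have h1 := key _ measurableSet_Iic hv
  have h2 := key _ measurableSet_Iic.compl (by
    rw [prob_compl_eq_one_sub measurableSet_Iic, hv, ENNReal.one_sub_inv_two])
  rw [← hzn, ← restrict_add_compl ((hU 1).measurable measurableSet_Iic) z, two_mul]
  exact (norm_add_le _ _).trans (add_le_add h1 h2)

/-! ### Absolute continuity of the norm -/

lemma FatouProperty.norm_le_of_forall_le (hF : E.FatouProperty) (f : ℕ → E.carrier) (g : L0)
    (hfg : ∀ᵐ t : I, Tendsto (fun n => (f n : L0) t) atTop (𝓝 (g t))) {M : ℝ}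
    (hM : ∀ n, ‖f n‖ ≤ M) : ∃ hg : g ∈ E.carrier, ‖(⟨g, hg⟩ : E.carrier)‖ ≤ M := by
  obtain ⟨hg, hle⟩ := hF f g hfg ⟨M, by rintro _ ⟨n, rfl⟩; exact hM n⟩
  refine ⟨hg, hle.trans (liminf_le_of_le ?_ fun b hb => ?_)⟩
  · exact isBoundedUnder_of ⟨0, fun k => norm_nonneg _⟩
  · obtain ⟨n, hn⟩ := hb.exists
    exact hn.trans (hM n)

/-- A separable space with the Fatou property has absolutely continuous norm. -/
theorem exists_norm_restrict_lt (hsep : TopologicalSpace.SeparableSpace E.carrier)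
    (hF : E.FatouProperty) (f : E.carrier) {ε : ℝ} (hε : 0 < ε) :
    ∃ δ : ENNReal, 0 < δ ∧ ∀ (A : Set I) (hA : MeasurableSet A), volume A ≤ δ →
      ‖restrict A hA f‖ < ε := by
  by_contra! hcon
  choose A hA hvol hnorm using fun n : ℕ => hcon ((2⁻¹ : ENNReal) ^ n) (by
    apply pos_iff_ne_zero.2; exact pow_ne_zero _ (by simp))
  have hae : ∀ᵐ t : I, ∀ᶠ n in atTop, t ∉ A n := by
    refine ae_eventually_notMem (ne_top_of_le_ne_top ?_ (ENNReal.tsum_le_tsum hvol))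
    rw [ENNReal.tsum_geometric]
    simp
  let B : ℕ → Set I := fun n => ⋃ k ≥ n, A k
  have hB : ∀ n, MeasurableSet (B n) := fun n =>
    MeasurableSet.iUnion fun k => MeasurableSet.iUnion fun _ => hA k
  have hBanti : Antitone B := fun m n hmn => Set.iUnion₂_subset fun k hk =>
    Set.subset_iUnion₂_of_subset k (le_trans hmn hk) subset_rfl
  -- The sets `B m` decrease to a null set. If every block `B n \ B m` carried norm at most `ε / 2`,
  -- Fatou would give the same bound on `B n`, contradicting the choice of `A n`.
  have hnext : ∀ n, ∃ m, n < m ∧ ε / 2 < ‖restrict (B n \ B m) ((hB n).diff (hB m)) f‖ := by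
    intro n
    by_contra! hle
    obtain ⟨_, h1⟩ := hF.norm_le_of_forall_le (fun k => restrict (B n \ B (n + 1 + k)) ((hB n).diff (hB _)) f)
      (restrict (B n) (hB n) f : E.carrier) (by
        have h' : ∀ᵐ t : I, ∀ k, (restrict (B n \ B (n + 1 + k)) ((hB n).diff (hB _)) f : L0) t
          = (B n \ B (n + 1 + k)).indicator (f : L0) t := ae_all_iff.2 fun k =>
            coeFn_restrict _ _ f
        filter_upwards [h', hae, coeFn_restrict (B n) (hB n) f] with t h1 h2 h3
        obtain ⟨N, hN⟩ := eventually_atTop.1 h2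
        refine tendsto_const_nhds.congr' ?_
        filter_upwards [eventually_ge_atTop N] with k hk
        have : t ∉ B (n + 1 + k) := by
          simp only [B, Set.mem_iUnion, not_exists]
          intro j hj
          exact hN j (by omega)
        rw [h1, h3]
        by_cases ht : t ∈ B n <;> simp [ht, this]) fun k => hle _ (by omega)
    have h2 := norm_restrict_mono (hA n) (hB n)
      (Set.subset_iUnion₂_of_subset n le_rfl subset_rfl) f
    exact absurd ((hnorm n).trans (h2.trans h1)) (by linarith)
  choose next hlt hbig using hnext
  let φ : ℕ → ℕ := fun k => next^[k] 0
  have hφ : ∀ k, φ (k + 1) = next (φ k) := fun k => Function.iterate_succ_apply' _ _ _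
  have hφm : StrictMono φ := strictMono_nat_of_lt_succ fun k => by rw [hφ]; exact hlt _
  let C : ℕ → Set I := fun k => B (φ k) \ B (φ (k + 1))
  have hC : ∀ k, MeasurableSet (C k) := fun k => (hB _).diff (hB _)
  have hCbig : ∀ k, ε / 2 < ‖restrict (C k) (hC k) f‖ := fun k => by
    rw [restrict_congr (hC k) ((hB (φ k)).diff (hB (next (φ k)))) (by simp only [C, hφ])]
    exact hbig _
  have hCd : ∀ j k, j < k → Disjoint (C j) (C k) := fun j k hjk =>
    Set.disjoint_left.2 fun t h1 h2 => h1.2 (hBanti (hφm.monotone (Nat.succ_le_of_lt hjk)) h2.1)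
  have hCd' : ∀ j k, j ≠ k → Disjoint (C j) (C k) := fun j k hjk =>
    (lt_or_gt_of_ne hjk).elim (hCd j k) fun h => (hCd k j h).symm
  -- Unions of the disjoint blocks over subsets of `ℕ` give an uncountable `ε / 2`-separated family,
  -- which separability forbids.
  let D : Set ℕ → Set I := fun S => ⋃ k ∈ S, C k
  have hD : ∀ S, MeasurableSet (D S) := fun S =>
    MeasurableSet.biUnion (Set.to_countable S) fun k _ => hC k
  have hmem : ∀ S k, k ∈ S → C k ∩ D S = C k := fun S k hk =>
    Set.inter_eq_left.2 (Set.subset_biUnion_of_mem (u := C) hk)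
  have hnot : ∀ S k, k ∉ S → C k ∩ D S = ∅ := fun S k hk => by
    rw [← Set.disjoint_iff_inter_eq_empty]
    refine Set.disjoint_iUnion₂_right.2 fun j hj => hCd' k j ?_
    rintro rfl
    exact hk hj
  have hsepd : ∀ S T : Set ℕ, ∀ k ∈ S, k ∉ T →
      ε / 2 < ‖restrict (D S) (hD S) f - restrict (D T) (hD T) f‖ := by
    intro S T k hkS hkT
    refine (hCbig k).trans_le ?_
    have : restrict (C k) (hC k) (restrict (D S) (hD S) f - restrict (D T) (hD T) f)
        = restrict (C k) (hC k) f := by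
      rw [map_sub, restrict_restrict, restrict_restrict,
        restrict_congr _ (hC k) (hmem S k hkS), restrict_congr _ MeasurableSet.empty (hnot T k hkT)]
      have : restrict ∅ MeasurableSet.empty f = 0 := ext_ae (by
        filter_upwards [coeFn_restrict ∅ MeasurableSet.empty f, coeFn_zero (E := E)] with t h1 h2
        rw [h1, h2]; simp)
      rw [this, sub_zero]
    rw [← this]
    exact norm_restrict_le _ _ _
  have hunc : (Set.univ : Set (Set ℕ)).Countable := by
    refine Set.PairwiseDisjoint.countable_of_isOpen
      (s := fun S : Set ℕ => Metric.ball (restrict (D S) (hD S) f) (ε / 4)) ?_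
      (fun _ _ => Metric.isOpen_ball) (fun S _ => ⟨_, Metric.mem_ball_self (by linarith)⟩)
    intro S _ T _ hST
    refine Metric.ball_disjoint_ball ?_
    rw [dist_eq_norm]
    have : ∃ k, (k ∈ S ∧ k ∉ T) ∨ (k ∈ T ∧ k ∉ S) := by
      by_contra! hh
      exact hST (Set.ext fun k => ⟨fun h => (hh k).1 h, fun h => (hh k).2 h⟩)
    obtain ⟨k, ⟨h1, h2⟩ | ⟨h1, h2⟩⟩ := this
    · linarith [hsepd S T k h1 h2]
    · rw [norm_sub_rev]
      linarith [hsepd T S k h1 h2]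
  rw [Set.countable_univ_iff] at hunc
  obtain ⟨g, hg⟩ := exists_injective_nat (Set ℕ)
  exact Function.cantor_injective g hg

/-! ### Domination between sequences and weak nullness -/

/-- Linear combinations of `y` are dominated in norm, up to the factor `C`, by the corresponding
linear combinations of `x`. -/
def SpanLE (y x : ℕ → E.carrier) (C : ℝ) : Prop :=
  ∀ a : ℕ →₀ ℝ, ‖Finsupp.linearCombination ℝ y a‖ ≤ C * ‖Finsupp.linearCombination ℝ x a‖

lemma SpanLE.comp {y x : ℕ → E.carrier} {C : ℝ} (h : SpanLE y x C) (φ : ℕ → ℕ) :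
    SpanLE (y ∘ φ) (x ∘ φ) C := fun a => by
  simpa [Finsupp.linearCombination_mapDomain] using h (a.mapDomain φ)

lemma SpanLE.norm_sum_le {y x : ℕ → E.carrier} {C : ℝ} (h : SpanLE y x C) (φ : ℕ → ℕ) (m : ℕ) :
    ‖∑ k ∈ Finset.range m, y (φ k)‖ ≤ C * ‖∑ k ∈ Finset.range m, x (φ k)‖ := by
  simpa [map_sum] using h (∑ k ∈ Finset.range m, Finsupp.single (φ k) 1)

lemma WeaklyNull.comp {x : ℕ → E.carrier} (hx : E.WeaklyNull x) {φ : ℕ → ℕ} (hφ : StrictMono φ) :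
    E.WeaklyNull (x ∘ φ) := fun F => (hx F).comp hφ.tendsto_atTop

lemma WeaklyNull.add {x y : ℕ → E.carrier} (hx : E.WeaklyNull x) (hy : E.WeaklyNull y) :
    E.WeaklyNull fun n => x n + y n := fun F => by simpa using (hx F).add (hy F)

lemma WeaklyNull.sub {x y : ℕ → E.carrier} (hx : E.WeaklyNull x) (hy : E.WeaklyNull y) :
    E.WeaklyNull fun n => x n - y n := fun F => by simpa using (hx F).sub (hy F)

lemma WeaklyNull.map {x : ℕ → E.carrier} (hx : E.WeaklyNull x) (T : E.carrier →L[ℝ] E.carrier) :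
    E.WeaklyNull fun n => T (x n) := fun F => hx (F.comp T)

lemma weaklyNull_of_tendsto {x : ℕ → E.carrier} (hx : Tendsto x atTop (𝓝 0)) :
    E.WeaklyNull x := fun F => by
  simpa [Function.comp_def] using (F.continuous.tendsto 0).comp hx

/-- Uniform boundedness for the terms viewed in the bidual, where they keep their norms. -/
lemma WeaklyNull.bddAbove {x : ℕ → E.carrier} (hx : E.WeaklyNull x) :
    BddAbove (Set.range fun n => ‖x n‖) := by
  obtain ⟨C, hC⟩ := banach_steinhaus
    (g := fun n => NormedSpace.inclusionInDoubleDual ℝ E.carrier (x n)) fun F => by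
      obtain ⟨C, hC⟩ := (hx F).norm.bddAbove_range
      exact ⟨C, fun n => hC ⟨n, rfl⟩⟩
  refine ⟨C, ?_⟩
  rintro _ ⟨n, rfl⟩
  have h : ‖NormedSpace.inclusionInDoubleDualLi ℝ (x n)‖ ≤ C := hC n
  rwa [LinearIsometry.norm_map] at h

/-- Weak convergence to zero passes to dominated sequences. -/
theorem WeaklyNull.of_spanLE {y x : ℕ → E.carrier} {C : ℝ} (hx : E.WeaklyNull x)
    (h : SpanLE y x C) : E.WeaklyNull y := by
  intro F
  let T := Finsupp.linearCombination ℝ x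
  let S := Finsupp.linearCombination ℝ y
  -- Domination makes `T a ↦ F (S a)` well defined and bounded on the span of `x`. A Hahn–Banach
  -- extension `H` then satisfies `H (x n) = F (y n)`.
  have hker : LinearMap.ker T ≤ LinearMap.ker (F.toLinearMap ∘ₗ S) := fun a ha => by
    have h1 : ‖S a‖ ≤ C * ‖T a‖ := h a
    rw [LinearMap.mem_ker.1 ha, norm_zero, mul_zero] at h1
    simp [norm_le_zero_iff.1 h1]
  let G₀ : LinearMap.range T →ₗ[ℝ] ℝ :=
    (LinearMap.ker T).liftQ (F.toLinearMap ∘ₗ S) hker ∘ₗ T.quotKerEquivRange.symm.toLinearMap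
  have hG₀ : ∀ a, G₀ ⟨T a, a, rfl⟩ = F (S a) := fun a => by
    have : T.quotKerEquivRange.symm ⟨T a, a, rfl⟩ = (LinearMap.ker T).mkQ a := by
      rw [LinearEquiv.symm_apply_eq]
      rfl
    simp only [G₀, LinearMap.comp_apply, LinearEquiv.coe_coe, this]
    rfl
  let G : StrongDual ℝ (LinearMap.range T) := G₀.mkContinuous (‖F‖ * C) (by
    rintro ⟨_, a, rfl⟩
    rw [hG₀]
    calc ‖F (S a)‖ ≤ ‖F‖ * ‖S a‖ := F.le_opNorm _
      _ ≤ ‖F‖ * (C * ‖T a‖) := by gcongr; exact h a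
      _ = _ := by rw [mul_assoc]; rfl)
  obtain ⟨H, hH, -⟩ := exists_extension_norm_eq _ G
  refine (hx H).congr fun n => ?_
  have h1 : T (Finsupp.single n 1) = x n := by simp [T]
  have h2 : S (Finsupp.single n 1) = y n := by simp [S]
  rw [← h1, ← h2, ← hG₀]
  exact hH ⟨T (Finsupp.single n 1), _, rfl⟩

/-- Sequences with the same joint distribution are isometrically equivalent. -/
lemma spanLE_of_identDistrib {y x : ℕ → E.carrier}
    (h : IdentDistrib (fun t n => (y n : L0) t) (fun t n => (x n : L0) t)
      (volume : Measure I) volume) : SpanLE y x 1 := by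
  intro a
  have hc : ∀ z : ℕ → E.carrier, ((Finsupp.linearCombination ℝ z a : E.carrier) : L0)
      =ᵐ[volume] fun t => ∑ n ∈ a.support, a n * (z n : L0) t := fun z => by
    rw [Finsupp.linearCombination_apply, Finsupp.sum]
    have h' : ∀ᵐ t : I, ∀ n, ((a n • z n : E.carrier) : L0) t = a n * (z n : L0) t :=
      ae_all_iff.2 fun n => coeFn_smul _ _
    filter_upwards [coeFn_sum a.support fun n => a n • z n, h'] with t h1 h2
    rw [h1]
    exact Finset.sum_congr rfl fun n _ => h2 n
  rw [one_mul]
  refine (norm_eq_of_identDistrib _ _ ?_).le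
  exact ((IdentDistrib.of_ae_eq (AEEqFun.measurable _).aemeasurable (hc y)).trans
    (h.comp (u := fun ω : ℕ → ℝ => ∑ n ∈ a.support, a n * ω n) (by fun_prop))).trans
    (IdentDistrib.of_ae_eq (AEEqFun.measurable _).aemeasurable (hc x)).symm

lemma distr_add (u v : E.carrier) (h : ∀ᵐ t : I, (u : L0) t = 0 ∨ (v : L0) t = 0) {s : ℝ}
    (hs : 0 ≤ s) : distr ((u + v : E.carrier) : L0) s = distr (u : L0) s + distr (v : L0) s := by
  have hm : ∀ w : E.carrier, MeasurableSet {t : I | s < |(w : L0) t|} := fun w =>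
    measurableSet_lt measurable_const (continuous_abs.measurable.comp (w : L0).measurable)
  unfold distr
  rw [← measure_union₀ (hm v).nullMeasurableSet]
  · refine measure_congr ?_
    filter_upwards [h, coeFn_add u v] with t h1 h2
    refine propext ?_
    change s < |_| ↔ (s < |_| ∨ s < |_|)
    rw [h2]
    rcases h1 with h1 | h1 <;> simp [h1, hs.not_gt]
  · refine measure_mono_null (t := {t | ¬ ((u : L0) t = 0 ∨ (v : L0) t = 0)}) ?_ h
    rintro t ⟨h1, h2⟩
    rintro (h3 | h3)
    · simp [h3, hs.not_gt] at h1
    · simp [h3, hs.not_gt] at h2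

lemma distr_smul_le (u v : E.carrier) (C : ENNReal)
    (h : ∀ s : ℝ, 0 ≤ s → distr (u : L0) s ≤ C * distr (v : L0) s) (c s : ℝ) (hs : 0 ≤ s) :
    distr ((c • u : E.carrier) : L0) s ≤ C * distr ((c • v : E.carrier) : L0) s := by
  rcases eq_or_ne c 0 with rfl | hc
  · have : distr ((((0 : ℝ) • u : E.carrier)) : L0) s = 0 := by
      rw [distr_congr (coeFn_smul 0 u)]
      simp [distr, hs.not_gt]
    rw [this]
    exact zero_le
  · have : ∀ w : E.carrier, distr ((c • w : E.carrier) : L0) s = distr (w : L0) (s / |c|) := by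
      intro w
      rw [distr_congr (coeFn_smul c w)]
      simp only [distr, abs_mul, div_lt_iff₀' (abs_pos.2 hc)]
    rw [this, this]
    exact h _ (by positivity)

/-- At almost every point at most one term is nonzero, so distribution functions add. Termwise
comparisons therefore pass to all linear combinations. -/
lemma distr_linearCombination {x : ℕ → E.carrier} (hx : E.PairwiseDisjoint x) (a : ℕ →₀ ℝ) {s : ℝ}
    (hs : 0 ≤ s) : distr ((Finsupp.linearCombination ℝ x a : E.carrier) : L0) s
      = ∑ n ∈ a.support, distr ((a n • x n : E.carrier) : L0) s := by
  rw [Finsupp.linearCombination_apply, Finsupp.sum]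
  induction a.support using Finset.induction_on with
  | empty =>
    rw [Finset.sum_empty, Finset.sum_empty, distr_congr (coeFn_zero (E := E))]
    simp [distr, hs.not_gt]
  | insert n S hn ih =>
    rw [Finset.sum_insert hn, Finset.sum_insert hn, distr_add _ _ _ hs, ih]
    have h1 : ∀ᵐ t : I, ∀ k, n ≠ k → (x n : L0) t = 0 ∨ (x k : L0) t = 0 := by
      rw [ae_all_iff]
      intro k
      by_cases hk : n = k
      · simp [hk]
      · simpa [hk] using hx n k hk
    have h2 : ∀ᵐ t : I, ∀ k, ((a k • x k : E.carrier) : L0) t = a k * (x k : L0) t :=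
      ae_all_iff.2 fun k => coeFn_smul _ _
    filter_upwards [h1, h2, coeFn_sum S fun k => a k • x k] with t h1 h2 h3
    rw [h2, h3]
    by_cases h : (x n : L0) t = 0
    · simp [h]
    · right
      refine Finset.sum_eq_zero fun k hk => ?_
      have hnk : n ≠ k := fun h' => hn (h' ▸ hk)
      rw [h2, (h1 k hnk).resolve_left h, mul_zero]

lemma distr_linearCombination_le {y x : ℕ → E.carrier} (hy : E.PairwiseDisjoint y)
    (hx : E.PairwiseDisjoint x) (C : ENNReal)
    (h : ∀ n, ∀ s : ℝ, 0 ≤ s → distr (y n : L0) s ≤ C * distr (x n : L0) s) (a : ℕ →₀ ℝ) {s : ℝ}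
    (hs : 0 ≤ s) : distr ((Finsupp.linearCombination ℝ y a : E.carrier) : L0) s
      ≤ C * distr ((Finsupp.linearCombination ℝ x a : E.carrier) : L0) s := by
  rw [distr_linearCombination hy a hs, distr_linearCombination hx a hs, Finset.mul_sum]
  exact Finset.sum_le_sum fun n _ => distr_smul_le _ _ C (h n) _ _ hs

lemma spanLE_of_distr_le {y x : ℕ → E.carrier} (hy : E.PairwiseDisjoint y)
    (hx : E.PairwiseDisjoint x)
    (h : ∀ n, ∀ s : ℝ, 0 ≤ s → distr (y n : L0) s ≤ distr (x n : L0) s) : SpanLE y x 1 :=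
  fun a => by
    rw [one_mul]
    exact norm_le_of_distr_le _ _ fun s hs => by
      simpa using distr_linearCombination_le hy hx 1 (by simpa using h) a hs

lemma spanLE_two_of_distr_le {y x : ℕ → E.carrier} (hy : E.PairwiseDisjoint y)
    (hx : E.PairwiseDisjoint x)
    (h : ∀ n, ∀ s : ℝ, 0 ≤ s → distr (y n : L0) s ≤ 2 * distr (x n : L0) s) : SpanLE y x 2 :=
  fun a => norm_le_two_mul_of_distr_le _ _ fun _ hs => distr_linearCombination_le hy hx 2 h a hs

/-! ### Stability of BS-sequences -/

lemma IsBSSeq.comp {p : ℝ} {x : ℕ → E.carrier} (hx : E.IsBSSeq p x) {φ : ℕ → ℕ}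
    (hφ : StrictMono φ) : E.IsBSSeq p (x ∘ φ) :=
  ⟨hx.1.mono (Set.range_subset_iff.2 fun n => Set.mem_range.2 ⟨φ n, rfl⟩),
    fun _ hψ => hx.2 _ (hφ.comp hψ)⟩

lemma IsBSSeq.of_spanLE {p C : ℝ} {y x : ℕ → E.carrier} (hx : E.IsBSSeq p x) (hC : 0 ≤ C)
    (h : SpanLE y x C) : E.IsBSSeq p y := by
  constructor
  · obtain ⟨M, hM⟩ := hx.1
    refine ⟨C * M, ?_⟩
    rintro _ ⟨n, rfl⟩
    -- A one-term sum along a constant index recovers the norm of a single term.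
    have := h.norm_sum_le (fun _ => n) 1
    simp only [Finset.sum_range_one] at this
    exact this.trans (mul_le_mul_of_nonneg_left (hM ⟨n, rfl⟩) hC)
  · intro φ hφ
    obtain ⟨M, hM⟩ := hx.2 φ hφ
    refine ⟨C * M, fun m hm => ?_⟩
    calc _ ≤ (m : ℝ) ^ (-(1 / p)) * (C * ‖∑ k ∈ Finset.range m, x (φ k)‖) := by
          gcongr
          exact h.norm_sum_le φ m
      _ = C * ((m : ℝ) ^ (-(1 / p)) * ‖∑ k ∈ Finset.range m, x (φ k)‖) := by ring
      _ ≤ _ := mul_le_mul_of_nonneg_left (hM m hm) hC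

lemma IsBSSeq.add {p : ℝ} {y x : ℕ → E.carrier} (hy : E.IsBSSeq p y) (hx : E.IsBSSeq p x) :
    E.IsBSSeq p fun n => y n + x n := by
  constructor
  · obtain ⟨M, hM⟩ := hx.1
    obtain ⟨N, hN⟩ := hy.1
    refine ⟨N + M, ?_⟩
    rintro _ ⟨n, rfl⟩
    exact (norm_add_le _ _).trans (add_le_add (hN ⟨n, rfl⟩) (hM ⟨n, rfl⟩))
  · intro φ hφ
    obtain ⟨M, hM⟩ := hx.2 φ hφ
    obtain ⟨N, hN⟩ := hy.2 φ hφ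
    refine ⟨N + M, fun m hm => ?_⟩
    rw [Finset.sum_add_distrib]
    refine le_trans ?_ (add_le_add (hN m hm) (hM m hm))
    rw [← mul_add]
    gcongr
    exact norm_add_le _ _

/-- All partial sums are bounded and `m ^ (-(1 / p)) ≤ 1`. This absorbs the errors of truncation and
disjointification. -/
lemma isBSSeq_of_summable_norm {p : ℝ} (hp : 1 ≤ p) {x : ℕ → E.carrier}
    (hx : Summable fun n => ‖x n‖) : E.IsBSSeq p x := by
  constructor
  · refine ⟨∑' n, ‖x n‖, ?_⟩
    rintro _ ⟨n, rfl⟩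
    exact hx.le_tsum n fun _ _ => norm_nonneg _
  · intro φ hφ
    refine ⟨∑' n, ‖x (φ n)‖, fun m hm => ?_⟩
    have h1 : (m : ℝ) ^ (-(1 / p)) ≤ 1 :=
      Real.rpow_le_one_of_one_le_of_nonpos (by exact_mod_cast hm)
        (neg_nonpos.2 (by positivity))
    have h2 : ‖∑ k ∈ Finset.range m, x (φ k)‖ ≤ ∑' n, ‖x (φ n)‖ :=
      (norm_sum_le _ _).trans ((hx.comp_injective hφ.injective).sum_le_tsum _
        fun _ _ => norm_nonneg _)
    exact (mul_le_of_le_one_left (norm_nonneg _) h1).trans h2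

/-! ### Disjointification along a subsequence -/

/-- A sequence of sets with measures tending to zero has a subsequence each of whose tails is
negligible for the terms of a given sequence in the space. -/
theorem exists_subseq_norm_restrict_tail_le (hsep : TopologicalSpace.SeparableSpace E.carrier)
    (hF : E.FatouProperty) (f : ℕ → E.carrier) (A : ℕ → Set I) (hA : ∀ n, MeasurableSet (A n))
    (h0 : Tendsto (fun n => volume (A n)) atTop (𝓝 0)) :
    ∃ φ : ℕ → ℕ, StrictMono φ ∧ ∃ B : ℕ → Set I, ∃ hB : ∀ n, MeasurableSet (B n),
      (∀ n, B n = ⋃ k > n, A (φ k)) ∧ (∀ n, volume (B n) ≤ 2⁻¹) ∧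
      ∀ n, ‖restrict (B n) (hB n) (f (φ n))‖ ≤ (1 / 2) ^ n := by
  choose δ hδ hlt using fun n => exists_norm_restrict_lt hsep hF (f n)
    (pow_pos (one_half_pos (α := ℝ)) n)
  -- A set of measure at most `η n` is negligible for all of `f 0, …, f n` and has measure at most
  -- 1/2.
  let η : ℕ → ENNReal := fun n => (Finset.range (n + 1)).inf δ ⊓ 2⁻¹
  have hη : ∀ n, 0 < η n := fun n => lt_inf_iff.2
    ⟨(Finset.lt_inf_iff (by simp)).2 fun i _ => hδ i, by simp⟩
  have hanti : Antitone η := fun m n hmn =>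
    inf_le_inf_right _ (Finset.inf_mono (Finset.range_subset_range.2 (by omega)))
  -- The geometric factor makes the measures of all later sets sum to at most `η n`, since `η` is
  -- decreasing.
  have hnext : ∀ n, ∃ m, n < m ∧ volume (A m) ≤ η n * 2⁻¹ ^ (n + 1) := by
    intro n
    have hpos : 0 < η n * 2⁻¹ ^ (n + 1) := ENNReal.mul_pos (hη n).ne' (pow_ne_zero _ (by simp))
    obtain ⟨m, h1, h2⟩ := ((eventually_gt_atTop n).and
      ((tendsto_order.1 h0).2 _ hpos)).exists
    exact ⟨m, h1, h2.le⟩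
  choose next hn1 hn2 using hnext
  let φ : ℕ → ℕ := fun k => next^[k] 0
  have hφ : ∀ k, φ (k + 1) = next (φ k) := fun k => Function.iterate_succ_apply' _ _ _
  have hφm : StrictMono φ := strictMono_nat_of_lt_succ fun k => by rw [hφ]; exact hn1 _
  have hB : ∀ n, MeasurableSet (⋃ k > n, A (φ k)) := fun n =>
    MeasurableSet.iUnion fun k => MeasurableSet.iUnion fun _ => hA _
  have hvol : ∀ n, volume (⋃ k > n, A (φ k)) ≤ η (φ n) := by
    intro n
    have : (⋃ k > n, A (φ k)) ⊆ ⋃ i, A (φ (n + i + 1)) := by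
      refine Set.iUnion₂_subset fun k hk => ?_
      obtain ⟨i, rfl⟩ := Nat.exists_eq_add_of_lt hk
      exact Set.subset_iUnion (fun i => A (φ (n + i + 1))) i
    calc volume (⋃ k > n, A (φ k)) ≤ volume (⋃ i, A (φ (n + i + 1))) := measure_mono this
      _ ≤ ∑' i, volume (A (φ (n + i + 1))) := measure_iUnion_le _
      _ ≤ ∑' i, η (φ n) * 2⁻¹ ^ (i + 1) := by
          refine ENNReal.tsum_le_tsum fun i => ?_
          rw [hφ]
          refine (hn2 _).trans (mul_le_mul' (hanti (hφm.monotone (by omega))) ?_)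
          exact pow_le_pow_right_of_le_one' (by simp) (by
            have := hφm.id_le (n + i); simp only [id] at this; omega)
      _ = η (φ n) := by
          rw [ENNReal.tsum_mul_left, ENNReal.tsum_geometric_add_one]
          simp [ENNReal.inv_mul_cancel]
  refine ⟨φ, hφm, fun n => ⋃ k > n, A (φ k), hB, fun _ => rfl,
    fun n => (hvol n).trans inf_le_right, fun n => ?_⟩
  refine (hlt (φ n) _ (hB n) ((hvol n).trans (inf_le_left.trans
    (Finset.inf_le (Finset.self_mem_range_succ _))))).le.trans ?_
  exact pow_le_pow_of_le_one (by norm_num) (by norm_num) (hφm.id_le n)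

lemma measurableSet_ne_zero (x : L0) : MeasurableSet {t : I | x t ≠ 0} :=
  (x.measurable (measurableSet_singleton 0)).compl

/-- Almost disjoint supports in a probability space have summable measures. -/
lemma PairwiseDisjoint.tendsto_volume {x : ℕ → E.carrier} (hx : E.PairwiseDisjoint x) :
    Tendsto (fun n => volume {t : I | (x n : L0) t ≠ 0}) atTop (𝓝 0) := by
  refine ENNReal.tendsto_atTop_zero_of_tsum_ne_top ?_
  rw [← measure_iUnion₀]
  · exact measure_ne_top _ _
  · intro m n hmn
    refine measure_mono_null ?_ (hx m n hmn)
    rintro t ⟨h1, h2⟩ h3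
    exact h3.elim h1 h2
  · exact fun n => (measurableSet_ne_zero _).nullMeasurableSet

/-- Removing from each term of a sequence the supports of the later terms gives a disjoint
sequence. -/
lemma pairwiseDisjoint_restrict_compl {f : ℕ → E.carrier} {A B : ℕ → Set I}
    (hB : ∀ n, MeasurableSet (B n)) (hBA : ∀ n, B n = ⋃ k > n, A k)
    (hf : ∀ n, ∀ᵐ t : I, t ∉ A n → (f n : L0) t = 0) :
    E.PairwiseDisjoint fun n => restrict (B n)ᶜ (hB n).compl (f n) := by
  have key : ∀ m n, m < n → ∀ᵐ t : I, (restrict (B m)ᶜ (hB m).compl (f m) : L0) t = 0 ∨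
      (restrict (B n)ᶜ (hB n).compl (f n) : L0) t = 0 := by
    intro m n hmn
    filter_upwards [coeFn_restrict (B m)ᶜ (hB m).compl (f m),
      coeFn_restrict (B n)ᶜ (hB n).compl (f n), hf n] with t h1 h2 h3
    rw [h1, h2]
    by_cases ht : t ∈ A n
    · left
      have : t ∈ B m := by
        rw [hBA]
        exact Set.mem_iUnion₂.2 ⟨n, hmn, ht⟩
      simp [this]
    · right
      simp [Set.indicator, h3 ht]
  intro m n hmn
  rcases lt_or_gt_of_ne hmn with h | h
  · exact key m n h
  · filter_upwards [key n m h] with t ht using ht.symm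

/-! ### From independent to disjoint sequences -/

/-- Weakly null disjoint sequences are, up to a subsequence, equivalent to sequences of
independent functions. -/
theorem Γi_subset_Γd (hsep : TopologicalSpace.SeparableSpace E.carrier)
    (hF : E.FatouProperty) : E.Γi ⊆ E.Γd := by
  rintro p ⟨hp, hΓ⟩
  refine ⟨hp, fun x hx hdisj => ?_⟩
  obtain ⟨U, hU, hind⟩ := exists_iid_uniform
  have hxm : ∀ n, Measurable (x n : L0) := fun n => (x n : L0).measurable
  choose f hf _ using fun n => exists_mem_of_identDistrib (x n) (fun t => (x n : L0) (U n t))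
    (identDistrib_comp (hxm n) (hU n))
  have hfind : E.Independent f := by
    have h1 : iIndepFun (fun n t => (x n : L0) (U n t)) (volume : Measure I) :=
      hind.comp (fun n => (x n : L0)) hxm
    exact h1.congr fun n => (hf n).symm
  let A : ℕ → Set I := fun n => U n ⁻¹' {t : I | (x n : L0) t ≠ 0}
  have hA : ∀ n, MeasurableSet (A n) := fun n => (hU n).measurable (measurableSet_ne_zero _)
  have hA0 : Tendsto (fun n => volume (A n)) atTop (𝓝 0) :=
    hdisj.tendsto_volume.congr fun n =>
      ((hU n).measure_preimage (measurableSet_ne_zero _).nullMeasurableSet).symm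
  obtain ⟨φ, hφ, B, hB, hBA, hBvol, hBn⟩ := exists_subseq_norm_restrict_tail_le hsep hF f A hA hA0
  let e : ℕ → E.carrier := fun n => restrict (B n)ᶜ (hB n).compl (f (φ n))
  have he : E.PairwiseDisjoint e :=
    pairwiseDisjoint_restrict_compl (f := f ∘ φ) (A := A ∘ φ) hB hBA fun n => by
      filter_upwards [hf (φ n)] with t h1 h2
      rw [Function.comp, h1]
      simpa [A] using h2
  have hxφ : E.PairwiseDisjoint (x ∘ φ) := fun m n hmn => hdisj _ _ fun h => hmn (hφ.injective h)
  -- The copy `f (φ n)` depends only on `U (φ n)`, and `B n` only on later `U k`. By independence,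
  -- cutting off `B n` multiplies the distribution function by `volume (B n)ᶜ`.
  have hdistr : ∀ n, ∀ s : ℝ, 0 ≤ s →
      distr (e n : L0) s = distr (x (φ n) : L0) s * volume (B n)ᶜ := by
    intro n s hs
    have hms : MeasurableSet {t | s < |(x (φ n) : L0) t|} :=
      measurableSet_lt measurable_const (continuous_abs.measurable.comp (hxm _))
    have h1 : distr (e n : L0) s
        = volume (U (φ n) ⁻¹' {t | s < |(x (φ n) : L0) t|} ∩ (B n)ᶜ) := by
      refine measure_congr ?_
      filter_upwards [coeFn_restrict (B n)ᶜ (hB n).compl (f (φ n)), hf (φ n)] with t h1 h2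
      refine propext ?_
      change s < |(restrict (B n)ᶜ (hB n).compl (f (φ n)) : L0) t| ↔
        (s < |(x (φ n) : L0) (U (φ n) t)| ∧ t ∈ (B n)ᶜ)
      rw [h1]
      by_cases h' : t ∈ (B n)ᶜ
      · rw [Set.indicator_of_mem h', h2]
        simp only [h', and_true]
      · rw [Set.indicator_of_notMem h']
        simp [h', hs.not_gt]
    have hI := indep_iSup_of_disjoint (m := fun i => MeasurableSpace.comap (U i) inferInstance)
      (fun i => (hU i).measurable.comap_le) hind (S := {φ n}) (T := Set.Ioi (φ n)) (by simp)
    rw [h1, (Indep_iff _ _ _).1 hI, (hU _).measure_preimage hms.nullMeasurableSet]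
    · rfl
    · exact le_iSup₂ (f := fun i (_ : i ∈ ({φ n} : Set ℕ)) =>
        MeasurableSpace.comap (U i) inferInstance) (φ n) rfl _ ⟨_, hms, rfl⟩
    · rw [hBA]
      refine MeasurableSet.compl (MeasurableSet.iUnion fun k => MeasurableSet.iUnion fun hk => ?_)
      exact le_iSup₂ (f := fun i (_ : i ∈ Set.Ioi (φ n)) =>
        MeasurableSpace.comap (U i) inferInstance) (φ k) (hφ hk) _
          ⟨_, measurableSet_ne_zero _, rfl⟩
  have hcompl : ∀ n, 2⁻¹ ≤ volume (B n)ᶜ := fun n => by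
    rw [prob_compl_eq_one_sub (hB n), ← ENNReal.one_sub_inv_two]
    exact tsub_le_tsub_left (hBvol n) 1
  have hle1 : SpanLE e (x ∘ φ) 1 := spanLE_of_distr_le he hxφ fun n s hs => by
    rw [hdistr n s hs]
    exact mul_le_of_le_one_right' prob_le_one
  have hle2 : SpanLE (x ∘ φ) e 2 := spanLE_two_of_distr_le hxφ he fun n s hs => by
    rw [hdistr n s hs]
    calc distr (x (φ n) : L0) s = 2 * (distr (x (φ n) : L0) s * 2⁻¹) := by
          rw [mul_comm, mul_assoc, ENNReal.inv_mul_cancel (by simp) (by simp), mul_one]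
      _ ≤ _ := by gcongr; exact hcompl n
  -- Weak nullness travels from `x` to `e` by domination, then to the copies `f`, which differ from
  -- `e` by a norm-summable sequence. The BS property travels back the same way.
  have heW : E.WeaklyNull e := (hx.comp hφ).of_spanLE hle1
  let r : ℕ → E.carrier := fun n => restrict (B n) (hB n) (f (φ n))
  have hr : Summable fun n => ‖r n‖ :=
    Summable.of_nonneg_of_le (fun _ => norm_nonneg _) hBn summable_geometric_two
  have hfer : f ∘ φ = fun n => r n + e n := funext fun n => (restrict_add_compl (hB n) _).symm
  have hfW : E.WeaklyNull (f ∘ φ) := by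
    rw [hfer]
    exact (weaklyNull_of_tendsto (tendsto_zero_iff_norm_tendsto_zero.2 hr.tendsto_atTop_zero)).add
      heW
  obtain ⟨ψ, hψ, hBS⟩ := hΓ (f ∘ φ) hfW (hfind.precomp hφ.injective)
  have heBS : E.IsBSSeq p (e ∘ ψ) := by
    have h1 := hBS.add ((isBSSeq_of_summable_norm hp (x := fun n => - r n)
      (by simpa using hr)).comp hψ)
    convert h1 using 1
    funext n
    simp [hfer]
  exact ⟨φ ∘ ψ, hφ.comp hψ, heBS.of_spanLE zero_le_two (hle2.comp ψ)⟩

/-- Off its level set `x` is dominated by the constant `ε`. -/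
lemma norm_restrict_compl_le {u₁ : E.carrier} (hone : (u₁ : L0) =ᵐ[volume] fun _ => (1 : ℝ))
    (x : E.carrier) {ε : ℝ} (hε : 0 ≤ ε) (hA : MeasurableSet {t : I | ε < |(x : L0) t|}) :
    ‖restrict {t : I | ε < |(x : L0) t|}ᶜ hA.compl x‖ ≤ ε * ‖u₁‖ := by
  have h1 : ‖ε • u₁‖ = ε * ‖u₁‖ := by rw [norm_smul, Real.norm_of_nonneg hε]
  rw [← h1]
  refine norm_le_of_abs_le _ _ ?_
  filter_upwards [coeFn_restrict {t : I | ε < |(x : L0) t|}ᶜ hA.compl x, coeFn_smul ε u₁, hone]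
    with t h1 h2 h3
  rw [h1, h2, h3, mul_one, abs_of_nonneg hε]
  by_cases ht : t ∈ {t : I | ε < |(x : L0) t|}
  · rwa [Set.indicator_of_notMem (by simpa using ht), abs_zero]
  · rw [Set.indicator_of_mem (by simpa using ht)]
    exact not_lt.1 ht

/-- A weakly null sequence that tends to zero in measure contains an almost disjoint
subsequence. -/
theorem exists_isBSSeq_of_tendsto_distr (hsep : TopologicalSpace.SeparableSpace E.carrier)
    (hF : E.FatouProperty) {u₁ : E.carrier} (hone : (u₁ : L0) =ᵐ[volume] fun _ => (1 : ℝ)) {p : ℝ}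
    (hp : p ∈ E.Γd) {v : ℕ → E.carrier} (hv : E.WeaklyNull v)
    (hv0 : ∀ ε : ℝ, 0 < ε → Tendsto (fun n => distr (v n : L0) ε) atTop (𝓝 0)) :
    ∃ φ : ℕ → ℕ, StrictMono φ ∧ E.IsBSSeq p (v ∘ φ) := by
  -- Level and measure are both `2⁻ⁿ`: the part above the level lives on small sets, and the part
  -- below has summable norms.
  obtain ⟨ψ, hψ, hψv⟩ := extraction_forall_of_eventually (P := fun n k =>
    distr (v k : L0) ((1 / 2) ^ n) ≤ 2⁻¹ ^ n) fun n =>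
      ((tendsto_order.1 (hv0 _ (by positivity))).2 _
        (pos_iff_ne_zero.2 (pow_ne_zero _ (by simp)))).mono fun _ h => h.le
  let A : ℕ → Set I := fun n => {t : I | (1 / 2) ^ n < |(v (ψ n) : L0) t|}
  have hA : ∀ n, MeasurableSet (A n) := fun n =>
    measurableSet_lt measurable_const (continuous_abs.measurable.comp (v (ψ n) : L0).measurable)
  have hA0 : Tendsto (fun n => volume (A n)) atTop (𝓝 0) :=
    tendsto_of_tendsto_of_tendsto_of_le_of_le tendsto_const_nhds
      (ENNReal.tendsto_pow_atTop_nhds_zero_of_lt_one (by simp)) (fun _ => zero_le) hψv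
  let f : ℕ → E.carrier := fun n => restrict (A n) (hA n) (v (ψ n))
  let w : ℕ → E.carrier := fun n => restrict (A n)ᶜ (hA n).compl (v (ψ n))
  have hw : ∀ n, ‖w n‖ ≤ (1 / 2) ^ n * ‖u₁‖ := fun n =>
    norm_restrict_compl_le hone _ (by positivity) (hA n)
  obtain ⟨φ, hφ, B, hB, hBA, -, hBn⟩ := exists_subseq_norm_restrict_tail_le hsep hF f A hA hA0
  let e : ℕ → E.carrier := fun n => restrict (B n)ᶜ (hB n).compl (f (φ n))
  let r : ℕ → E.carrier := fun n => restrict (B n) (hB n) (f (φ n)) + w (φ n)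
  have he : E.PairwiseDisjoint e :=
    pairwiseDisjoint_restrict_compl (f := f ∘ φ) (A := A ∘ φ) hB hBA fun n => by
      filter_upwards [coeFn_restrict (A (φ n)) (hA (φ n)) (v (ψ (φ n)))] with t h1 h2
      exact h1.trans (Set.indicator_of_notMem h2 _)
  have hver : v ∘ ψ ∘ φ = fun n => r n + e n := funext fun n => by
    have h1 := restrict_add_compl (hA (φ n)) (v (ψ (φ n)))
    have h2 := restrict_add_compl (hB n) (f (φ n))
    calc v (ψ (φ n)) = f (φ n) + w (φ n) := h1.symm
      _ = (restrict (B n) (hB n) (f (φ n)) + e n) + w (φ n) := by rw [h2]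
      _ = _ := by simp only [r]; abel
  have hr : Summable fun n => ‖r n‖ := by
    refine Summable.of_nonneg_of_le (fun _ => norm_nonneg _) (fun n => ?_)
      (summable_geometric_two.mul_right (1 + ‖u₁‖))
    calc ‖r n‖ ≤ (1 / 2) ^ n + (1 / 2) ^ φ n * ‖u₁‖ :=
          (norm_add_le _ _).trans (add_le_add (hBn n) (hw _))
      _ ≤ (1 / 2) ^ n + (1 / 2) ^ n * ‖u₁‖ := by
          exact add_le_add le_rfl (mul_le_mul_of_nonneg_right
            (pow_le_pow_of_le_one (by norm_num) (by norm_num) (hφ.id_le n)) (norm_nonneg _))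
      _ = _ := by ring
  -- The disjoint part differs from a weakly null sequence by a norm-null one, so `p ∈ Γd` applies
  -- to it.
  have heW : E.WeaklyNull e := by
    have h1 := (hv.comp (hψ.comp hφ)).sub
      (weaklyNull_of_tendsto (tendsto_zero_iff_norm_tendsto_zero.2 hr.tendsto_atTop_zero))
    convert h1 using 1
    funext n
    rw [hver]
    simp
  obtain ⟨χ, hχ, hBS⟩ := hp.2 e heW he
  refine ⟨ψ ∘ φ ∘ χ, hψ.comp (hφ.comp hχ), ?_⟩
  have h1 := ((isBSSeq_of_summable_norm hp.1 hr).comp hχ).add hBS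
  convert h1 using 1
  funext n
  exact congrFun hver (χ n)

/-! ### Constants belong to a nontrivial space -/

lemma volume_coe_Ioc_le (a b : ℝ) :
    volume {t : I | a < (t : ℝ) ∧ (t : ℝ) ≤ b} ≤ ENNReal.ofReal (b - a) := by
  have := unitInterval.measurePreserving_coe.measure_preimage
    (measurableSet_Ioc (a := a) (b := b)).nullMeasurableSet
  calc _ = (volume.restrict I) (Set.Ioc a b) := this
    _ ≤ volume (Set.Ioc a b) := Measure.restrict_apply_le _ _
    _ = _ := Real.volume_Ioc

/-- A nontrivial rearrangement-invariant space contains the constants. -/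
theorem exists_one_mem {y : E.carrier} (hy : y ≠ 0) :
    ∃ u : E.carrier, (u : L0) =ᵐ[volume] fun _ => (1 : ℝ) := by
  obtain ⟨ε, hε, hpos⟩ : ∃ ε : ℝ, 0 < ε ∧ distr (y : L0) ε ≠ 0 := by
    by_contra! h
    refine hy (ext_ae ?_)
    have h1 : ∀ᵐ t : I, ∀ n : ℕ, ¬ (1 / ((n : ℝ) + 1) < |(y : L0) t|) :=
      ae_all_iff.2 fun n => by
        have := h (1 / ((n : ℝ) + 1)) (by positivity)
        simpa [ae_iff, distr] using this
    filter_upwards [h1, coeFn_zero (E := E)] with t h1 h2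
    rw [h2]
    by_contra h3
    obtain ⟨n, hn⟩ := exists_nat_one_div_lt (abs_pos.2 h3)
    exact h1 n hn
  obtain ⟨c, hc, hcy⟩ : ∃ c : ℝ, 0 < c ∧ ENNReal.ofReal c = distr (y : L0) ε :=
    ⟨(distr (y : L0) ε).toReal, ENNReal.toReal_pos hpos (measure_ne_top _ _),
      ENNReal.ofReal_toReal (measure_ne_top _ _)⟩
  -- As `|y| > ε` on a set of measure `c`, the indicator of any interval of length `c` is dominated
  -- in distribution by `ε⁻¹ • y`. Finitely many such intervals cover `(0,1)`.
  have hstep : ∀ a : ℝ, ∃ z : E.carrier, (z : L0) =ᵐ[volume]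
      Set.indicator {t : I | a < (t : ℝ) ∧ (t : ℝ) ≤ a + c} fun _ => (1 : ℝ) := by
    intro a
    have hms : MeasurableSet {t : I | a < (t : ℝ) ∧ (t : ℝ) ≤ a + c} :=
      (measurableSet_lt measurable_const measurable_subtype_coe).inter
        (measurableSet_le measurable_subtype_coe measurable_const)
    obtain ⟨z, hz, -⟩ := exists_mem_of_distr_le (ε⁻¹ • y) (Set.indicator
      {t : I | a < (t : ℝ) ∧ (t : ℝ) ≤ a + c} fun _ => (1 : ℝ))
      (measurable_const.indicator hms).aemeasurable (by
        intro s hs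
        rw [distr_congr (coeFn_smul _ _)]
        rcases lt_or_ge s 1 with h1 | h1
        · calc distr _ s ≤ volume {t : I | a < (t : ℝ) ∧ (t : ℝ) ≤ a + c} := by
                refine measure_mono fun t ht => ?_
                by_contra h
                rw [Set.mem_ofPred_eq, Set.indicator_of_notMem h, abs_zero] at ht
                exact hs.not_gt ht
            _ ≤ ENNReal.ofReal c := by simpa using volume_coe_Ioc_le a (a + c)
            _ = distr (y : L0) ε := hcy
            _ ≤ _ := by
                refine measure_mono fun t ht => ?_
                have ht' : ε < |(y : L0) t| := ht
                change s < |ε⁻¹ * (y : L0) t|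
                rw [abs_mul, abs_of_pos (inv_pos.2 hε), inv_mul_eq_div, lt_div_iff₀ hε]
                nlinarith
        · have : distr (Set.indicator {t : I | a < (t : ℝ) ∧ (t : ℝ) ≤ a + c}
              fun _ => (1 : ℝ)) s = 0 := by
            refine measure_mono_null (t := ∅) (fun t ht => ?_) measure_empty
            have ht' : s < |Set.indicator {t : I | a < (t : ℝ) ∧ (t : ℝ) ≤ a + c}
              (fun _ => (1 : ℝ)) t| := ht
            by_cases h : t ∈ {t : I | a < (t : ℝ) ∧ (t : ℝ) ≤ a + c}
            · rw [Set.indicator_of_mem h, abs_one] at ht'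
              exact h1.not_gt ht'
            · rw [Set.indicator_of_notMem h, abs_zero] at ht'
              exact hs.not_gt ht'
          rw [this]
          exact zero_le)
    exact ⟨z, hz⟩
  have hall : ∀ n : ℕ, ∃ z : E.carrier, (z : L0) =ᵐ[volume]
      Set.indicator {t : I | 0 < (t : ℝ) ∧ (t : ℝ) ≤ n * c} fun _ => (1 : ℝ) := by
    intro n
    induction n with
    | zero =>
      refine ⟨0, ?_⟩
      filter_upwards [coeFn_zero (E := E)] with t ht
      rw [ht, Set.indicator_of_notMem]
      rintro ⟨h1, h2⟩
      simp only [Nat.cast_zero, zero_mul] at h2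
      exact h1.not_ge h2
    | succ n ih =>
      obtain ⟨z, hz⟩ := ih
      obtain ⟨u, hu⟩ := hstep (n * c)
      refine ⟨z + u, ?_⟩
      filter_upwards [coeFn_add z u, hz, hu] with t h1 h2 h3
      rw [h1, h2, h3]
      have h0 : 0 ≤ n * c := by positivity
      have h4 : ((n + 1 : ℕ) : ℝ) * c = n * c + c := by push_cast; ring
      simp only [Set.indicator_apply, Set.mem_ofPred_eq, h4]
      grind
  obtain ⟨n, hn⟩ := exists_nat_gt (1 / c)
  obtain ⟨z, hz⟩ := hall n
  refine ⟨z, ?_⟩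
  filter_upwards [hz, ae_mem_Ioo] with t h1 h2
  rw [h1, Set.indicator_of_mem]
  exact ⟨h2.1, h2.2.le.trans ((div_lt_iff₀ hc).1 hn).le⟩

end RISpace

/-! ### Helly's theorem -/

/-- **Helly's selection theorem** for pointwise bounded sequences of monotone functions. -/
theorem exists_subseq_tendsto_of_monotoneOn (g : ℕ → ℝ → ℝ)
    (hmono : ∀ n, MonotoneOn (g n) (Set.Ioo 0 1))
    (hbdd : ∀ t ∈ Set.Ioo (0 : ℝ) 1, ∃ M, ∀ n, |g n t| ≤ M) :
    ∃ φ : ℕ → ℕ, StrictMono φ ∧ ∃ G : ℝ → ℝ, ∀ᵐ t : I,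
      Tendsto (fun n => g (φ n) t) atTop (𝓝 (G t)) := by
  choose! M hM using hbdd
  let R := {q : ℚ // (q : ℝ) ∈ Set.Ioo (0 : ℝ) 1}
  -- Compactness of a countable product of intervals replaces the diagonal argument: the subsequence
  -- converges at every rational.
  obtain ⟨L, -, φ, hφ, hL⟩ := (isCompact_univ_pi fun q : R =>
    (isCompact_Icc (a := -M (q : ℚ)) (b := M (q : ℚ)))).tendsto_subseq
      (x := fun n (q : R) => g n (q : ℚ)) fun n q _ => abs_le.1 (hM _ q.2 n)
  rw [tendsto_pi_nhds] at hL
  let l : ℝ → ℝ := fun t => liminf (fun n => g (φ n) t) atTop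
  let u : ℝ → ℝ := fun t => limsup (fun n => g (φ n) t) atTop
  have hb1 : ∀ t ∈ Set.Ioo (0 : ℝ) 1, IsBoundedUnder (· ≤ ·) atTop fun n => g (φ n) t :=
    fun t ht => isBoundedUnder_of ⟨M t, fun n => (abs_le.1 (hM t ht _)).2⟩
  have hb2 : ∀ t ∈ Set.Ioo (0 : ℝ) 1, IsBoundedUnder (· ≥ ·) atTop fun n => g (φ n) t :=
    fun t ht => isBoundedUnder_of ⟨-M t, fun n => (abs_le.1 (hM t ht _)).1⟩
  have hu : ∀ t ∈ Set.Ioo (0 : ℝ) 1, ∀ q : R, t ≤ (q : ℚ) → u t ≤ L q := by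
    intro t ht q hq
    rw [← (hL q).limsup_eq]
    exact limsup_le_limsup (Eventually.of_forall fun n => hmono _ ht q.2 hq)
      (hb2 t ht).isCoboundedUnder_le (hb1 _ q.2)
  have hl : ∀ t ∈ Set.Ioo (0 : ℝ) 1, ∀ q : R, ((q : ℚ) : ℝ) ≤ t → L q ≤ l t := by
    intro t ht q hq
    rw [← (hL q).liminf_eq]
    exact liminf_le_liminf (Eventually.of_forall fun n => hmono _ q.2 ht hq)
      (hb2 _ q.2) (hb1 t ht).isCoboundedUnder_ge
  have hul : ∀ s ∈ Set.Ioo (0 : ℝ) 1, ∀ t ∈ Set.Ioo (0 : ℝ) 1, s < t → u s ≤ l t := by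
    intro s hs t ht hst
    obtain ⟨q, h1, h2⟩ := exists_rat_btwn hst
    exact (hu s hs ⟨q, hs.1.trans h1, h2.trans ht.2⟩ h1.le).trans (hl t ht _ h2.le)
  have hlu : ∀ t ∈ Set.Ioo (0 : ℝ) 1, l t ≤ u t := fun t ht =>
    liminf_le_limsup (hb1 t ht) (hb2 t ht)
  have hlm : MonotoneOn l (Set.Ioo 0 1) := by
    intro s hs t ht hst
    rcases hst.eq_or_lt with rfl | h
    · exact le_rfl
    · exact (hlu s hs).trans (hul s hs t ht h)
  refine ⟨φ, hφ, l, ?_⟩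
  -- The monotone lower limit `l` is continuous off a countable set. At a continuity point `t`,
  -- letting `s ↓ t` in `u t ≤ l s` gives `u t ≤ l t`.
  have hcount : ∀ᵐ t : I, (t : ℝ) ∉ {x ∈ Set.Ioo (0 : ℝ) 1 |
      ¬ContinuousWithinAt l (Set.Ioo 0 1) x} :=
    (hlm.countable_not_continuousWithinAt.preimage Subtype.val_injective).ae_notMem _
  filter_upwards [hcount, ae_mem_Ioo] with t h1 ht
  have hc : ContinuousAt l t := by
    by_contra h
    exact h1 ⟨ht, fun h' => h (h'.continuousAt (isOpen_Ioo.mem_nhds ht))⟩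
  have hle : u t ≤ l t := by
    refine ge_of_tendsto (hc.mono_left nhdsWithin_le_nhds : Tendsto l (𝓝[>] (t : ℝ)) _) ?_
    filter_upwards [self_mem_nhdsWithin, nhdsWithin_le_nhds (isOpen_Ioo.mem_nhds ht)] with s hs hs'
    exact hul t ht s hs' hs
  exact tendsto_of_liminf_eq_limsup rfl (le_antisymm hle (hlu t ht)) (hb1 t ht) (hb2 t ht)

/-! ### Laws of large numbers and weak nullness of iid sequences -/

namespace RISpace

variable {E : RISpace}

lemma norm_sum_div_le (f : ℕ → E.carrier) {M : ℝ} (hM : 0 ≤ M) (hf : ∀ n, ‖f n‖ ≤ M) (m : ℕ) :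
    ‖(m : ℝ)⁻¹ • ∑ k ∈ Finset.range m, f k‖ ≤ M := by
  rw [norm_smul, norm_inv, Real.norm_natCast]
  rcases Nat.eq_zero_or_pos m with rfl | hm
  · simpa using hM
  · rw [inv_mul_le_iff₀ (by exact_mod_cast hm)]
    calc _ ≤ ∑ k ∈ Finset.range m, ‖f k‖ := norm_sum_le _ _
      _ ≤ ∑ k ∈ Finset.range m, M := Finset.sum_le_sum fun k _ => hf k
      _ = _ := by simp

/-- The strong law of large numbers for copies of an element of the space. -/
lemma ae_tendsto_average (g : E.carrier) (hg : Integrable (g : L0) volume) {V : ℕ → I → I}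
    (hV : ∀ n, MeasurePreserving (V n) volume volume) (hind : iIndepFun V (volume : Measure I))
    (f : ℕ → E.carrier) (hf : ∀ n, (f n : L0) =ᵐ[volume] fun t => (g : L0) (V n t)) :
    ∀ᵐ t : I, Tendsto (fun m : ℕ => (((m : ℝ)⁻¹ • ∑ k ∈ Finset.range m, f k : E.carrier) : L0) t)
      atTop (𝓝 (∫ t, (g : L0) t)) := by
  have hgm : Measurable (g : L0) := (g : L0).measurable
  have hid : ∀ n, IdentDistrib (fun t => (g : L0) (V n t)) (g : L0) (volume : Measure I) volume :=
    fun n => identDistrib_comp hgm (hV n)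
  have hslln := strong_law_ae_real (fun n t => (g : L0) (V n t)) ((hid 0).integrable_iff.2 hg)
    (fun i j hij => ((hind.comp (fun _ => (g : L0)) fun _ => hgm).indepFun hij))
    fun n => (hid n).trans (hid 0).symm
  rw [(hid 0).integral_eq] at hslln
  have hc : ∀ᵐ t : I, ∀ m : ℕ, (((m : ℝ)⁻¹ • ∑ k ∈ Finset.range m, f k : E.carrier) : L0) t
      = (∑ k ∈ Finset.range m, (g : L0) (V k t)) / m := by
    rw [ae_all_iff]
    intro m
    filter_upwards [coeFn_smul (m : ℝ)⁻¹ (∑ k ∈ Finset.range m, f k),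
      coeFn_sum (Finset.range m) f, ae_all_iff.2 hf] with t h1 h2 h3
    rw [h1, h2, inv_mul_eq_div]
    simp only [h3]
  filter_upwards [hslln, hc] with t h1 h2
  exact h1.congr fun m => (h2 m).symm

/-- A nontrivial space with the Fatou property consists of integrable functions. -/
theorem FatouProperty.integrable (hF : E.FatouProperty) {u₁ : E.carrier}
    (hone : (u₁ : L0) =ᵐ[volume] fun _ => (1 : ℝ)) (f : E.carrier) :
    Integrable (f : L0) volume := by
  have hfm : Measurable (f : L0) := (f : L0).measurable
  have hu : 0 < ‖u₁‖ := by
    rw [norm_pos_iff]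
    rintro rfl
    obtain ⟨t, h1, h2⟩ := (hone.and (coeFn_zero (E := E))).exists
    rw [h1] at h2
    exact one_ne_zero h2
  obtain ⟨U, hU, hind⟩ := exists_iid_uniform
  -- Averages of independent copies of the truncation have norm at most `‖f‖` and converge a.e. to
  -- its mean. Fatou bounds the mean times `‖u₁‖` by `‖f‖`, uniformly in `N`.
  have key : ∀ N : ℕ, ∫⁻ t, ENNReal.ofReal (min |(f : L0) t| N)
      ≤ ENNReal.ofReal (‖f‖ / ‖u₁‖) := by
    intro N
    have hgm : Measurable fun t => min |(f : L0) t| (N : ℝ) := by fun_prop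
    have hg0 : ∀ t, 0 ≤ min |(f : L0) t| (N : ℝ) := fun t => le_min (abs_nonneg _) (by positivity)
    obtain ⟨hx, hn⟩ := norm_le_of_ae_le f (AEEqFun.mk _ hgm.aestronglyMeasurable) (by
      filter_upwards [AEEqFun.coeFn_mk _ hgm.aestronglyMeasurable] with t ht
      rw [ht, abs_of_nonneg (hg0 t)]
      exact min_le_left _ _)
    set g : E.carrier := ⟨_, hx⟩
    have hgc : (g : L0) =ᵐ[volume] fun t => min |(f : L0) t| (N : ℝ) :=
      AEEqFun.coeFn_mk _ hgm.aestronglyMeasurable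
    have hgi : Integrable (fun t => min |(f : L0) t| (N : ℝ)) (volume : Measure I) :=
      Integrable.of_bound hgm.aestronglyMeasurable N (Eventually.of_forall fun t => by
        rw [Real.norm_of_nonneg (hg0 t)]
        exact min_le_right _ _)
    choose F hFc hFn using fun n => exists_mem_of_identDistrib g (fun t => (g : L0) (U n t))
      (identDistrib_comp (g : L0).measurable (hU n))
    have hslln := ae_tendsto_average g (hgi.congr hgc.symm) hU hind F hFc
    obtain ⟨_, hle⟩ := hF.norm_le_of_forall_le
      (fun m : ℕ => (m : ℝ)⁻¹ • ∑ k ∈ Finset.range m, F k)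
      (((∫ t, (g : L0) t) • u₁ : E.carrier) : L0) (by
        filter_upwards [hslln, coeFn_smul (∫ t, (g : L0) t) u₁, hone] with t h1 h2 h3
        rw [h2, h3, mul_one]
        exact h1) (norm_sum_div_le F (norm_nonneg f) fun n => (hFn n).le.trans hn)
    have hle' : ‖(∫ t, (g : L0) t) • u₁‖ ≤ ‖f‖ := hle
    rw [norm_smul, ← le_div_iff₀ hu] at hle'
    rw [← ofReal_integral_eq_lintegral_ofReal hgi (Eventually.of_forall hg0)]
    refine ENNReal.ofReal_le_ofReal (le_trans ?_ hle')
    rw [integral_congr_ae hgc]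
    exact le_abs_self _
  refine ⟨hfm.aestronglyMeasurable, ?_⟩
  have h1 : ∫⁻ t, liminf (fun N : ℕ => ENNReal.ofReal (min |(f : L0) t| N)) atTop
      ≤ ENNReal.ofReal (‖f‖ / ‖u₁‖) :=
    (lintegral_liminf_le fun N => by fun_prop).trans
      (liminf_le_of_le (by isBoundedDefault) fun b hb => by
        obtain ⟨n, hn⟩ := hb.exists
        exact hn.trans (key n))
  have h2 : ∀ t, liminf (fun N : ℕ => ENNReal.ofReal (min |(f : L0) t| N)) atTop
      = ‖(f : L0) t‖ₑ := fun t => by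
    rw [← ofReal_norm, Real.norm_eq_abs]
    refine Tendsto.liminf_eq (tendsto_const_nhds.congr' ?_)
    obtain ⟨N, hN⟩ := exists_nat_ge |(f : L0) t|
    filter_upwards [eventually_ge_atTop N] with n hn
    rw [min_eq_left (hN.trans (by exact_mod_cast hn))]
  simp only [h2] at h1
  exact h1.trans_lt ENNReal.ofReal_lt_top

lemma tendsto_distr_natCast (f : E.carrier) :
    Tendsto (fun N : ℕ => distr (f : L0) N) atTop (𝓝 0) := by
  have := tendsto_measure_iInter_atTop (μ := (volume : Measure I))
    (s := fun N : ℕ => {t : I | (N : ℝ) < |(f : L0) t|})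
    (fun N => (measurableSet_lt measurable_const
      (continuous_abs.measurable.comp (f : L0).measurable)).nullMeasurableSet)
    (fun m n hmn t (ht : (n : ℝ) < _) => lt_of_le_of_lt (by exact_mod_cast hmn) ht)
    ⟨0, measure_ne_top _ _⟩
  have h0 : (volume : Measure I) (⋂ N : ℕ, {t : I | (N : ℝ) < |(f : L0) t|}) = 0 := by
    refine measure_mono_null (t := ∅) (fun t ht => ?_) measure_empty
    obtain ⟨N, hN⟩ := exists_nat_ge |(f : L0) t|
    exact absurd hN (not_le.2 (Set.mem_iInter.1 ht N))
  rwa [h0] at this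

lemma measurableSet_lt_abs (x : E.carrier) (ε : ℝ) : MeasurableSet {t : I | ε < |(x : L0) t|} :=
  measurableSet_lt measurable_const (continuous_abs.measurable.comp (x : L0).measurable)

/-- The norm is absolutely continuous uniformly over all functions with a given distribution. -/
lemma exists_norm_restrict_le_of_identDistrib (hsep : TopologicalSpace.SeparableSpace E.carrier)
    (hF : E.FatouProperty) {u₁ : E.carrier} (hone : (u₁ : L0) =ᵐ[volume] fun _ => (1 : ℝ))
    (g : E.carrier) {ε : ℝ} (hε : 0 < ε) :
    ∃ δ : ENNReal, 0 < δ ∧ ∀ f : E.carrier, IdentDistrib (f : L0) (g : L0) volume volume →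
      ∀ (A : Set I) (hA : MeasurableSet A), volume A ≤ δ → ‖restrict A hA f‖ ≤ ε := by
  obtain ⟨δ₀, hδ₀, h₀⟩ := exists_norm_restrict_lt hsep hF g (half_pos hε)
  obtain ⟨N, hN⟩ := ((tendsto_order.1 (tendsto_distr_natCast g)).2 _ hδ₀).exists
  -- The part of `f` above `N` has the norm of that of `g`; the part below is dominated by `N • u₁`.
  -- The `N + 1` avoids division by zero.
  obtain ⟨δ, hδ, h₁⟩ := exists_norm_restrict_lt hsep hF u₁ (ε := ε / 2 / (N + 1)) (by positivity)
  refine ⟨δ, hδ, fun f hf A hA hvol => ?_⟩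
  have hm := measurableSet_lt_abs f N
  have hmg := measurableSet_lt_abs g N
  have h2 : ‖restrict _ hm f‖ ≤ ε / 2 := by
    have : ‖restrict _ hm f‖ = ‖restrict _ hmg g‖ := by
      refine norm_eq_of_identDistrib _ _ ?_
      have hT : Measurable fun r : ℝ => Set.indicator {r : ℝ | (N : ℝ) < |r|} id r :=
        measurable_id.indicator (measurableSet_lt measurable_const (by fun_prop))
      exact ((IdentDistrib.of_ae_eq (AEEqFun.measurable _).aemeasurable
        (coeFn_restrict _ hm f)).trans (hf.comp hT)).trans
        (IdentDistrib.of_ae_eq (AEEqFun.measurable _).aemeasurable (coeFn_restrict _ hmg g)).symm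
    rw [this]
    exact (h₀ _ hmg hN.le).le
  have h3 : ‖restrict A hA (restrict _ hm.compl f)‖ ≤ ε / 2 := by
    calc _ ≤ ‖(N : ℝ) • restrict A hA u₁‖ := by
          refine norm_le_of_abs_le _ _ ?_
          filter_upwards [coeFn_restrict A hA (restrict _ hm.compl f), coeFn_restrict _ hm.compl f,
            coeFn_smul (N : ℝ) (restrict A hA u₁), coeFn_restrict A hA u₁, hone] with t k1 k2 k3 k4 k5
          rw [k1, k3, k4]
          by_cases ht : t ∈ A
          · rw [Set.indicator_of_mem ht, Set.indicator_of_mem ht, k2, k5, mul_one,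
              abs_of_nonneg (a := (N : ℝ)) (by positivity)]
            by_cases ht' : t ∈ {t : I | (N : ℝ) < |(f : L0) t|}
            · rw [Set.indicator_of_notMem (by simpa using ht'), abs_zero]
              positivity
            · rw [Set.indicator_of_mem (by simpa using ht')]
              exact not_lt.1 ht'
          · simp [ht]
      _ = N * ‖restrict A hA u₁‖ := by rw [norm_smul, Real.norm_natCast]
      _ ≤ N * (ε / 2 / (N + 1)) := by gcongr; exact (h₁ A hA hvol).le
      _ ≤ (N + 1) * (ε / 2 / (N + 1)) := by gcongr; linarith
      _ = ε / 2 := by field_simp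
  rw [← restrict_add_compl hm f, map_add]
  refine (norm_add_le _ _).trans ?_
  linarith [norm_restrict_le A hA (restrict _ hm f)]

/-- A sequence tending to zero in measure with equi-absolutely continuous norms tends to zero. -/
lemma tendsto_norm_zero {u₁ : E.carrier} (hone : (u₁ : L0) =ᵐ[volume] fun _ => (1 : ℝ))
    (a : ℕ → E.carrier)
    (h0 : ∀ ε : ℝ, 0 < ε → Tendsto (fun n => distr (a n : L0) ε) atTop (𝓝 0))
    (hac : ∀ ε : ℝ, 0 < ε → ∃ δ : ENNReal, 0 < δ ∧ ∀ n, ∀ (A : Set I) (hA : MeasurableSet A),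
      volume A ≤ δ → ‖restrict A hA (a n)‖ ≤ ε) : Tendsto a atTop (𝓝 0) := by
  rw [Metric.tendsto_atTop']
  intro ε hε
  obtain ⟨δ, hδ, h⟩ := hac (ε / 4) (by positivity)
  have hc : 0 < ε / 4 / (‖u₁‖ + 1) := by positivity
  obtain ⟨N, hN⟩ := eventually_atTop.1 ((tendsto_order.1 (h0 _ hc)).2 _ hδ)
  refine ⟨N, fun n hn => ?_⟩
  have hm := measurableSet_lt_abs (a n) (ε / 4 / (‖u₁‖ + 1))
  rw [dist_zero_right, ← restrict_add_compl hm (a n)]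
  have h1 := h n _ hm (hN n hn.le).le
  have h2 := norm_restrict_compl_le hone (a n) hc.le hm
  have h3 : ε / 4 / (‖u₁‖ + 1) * ‖u₁‖ ≤ ε / 4 / (‖u₁‖ + 1) * (‖u₁‖ + 1) := by
    gcongr
    linarith
  rw [div_mul_cancel₀ _ (by positivity)] at h3
  exact (norm_add_le _ _).trans_lt (by linarith)

lemma tendsto_distr_of_ae_tendsto (a : ℕ → E.carrier)
    (h : ∀ᵐ t : I, Tendsto (fun n => (a n : L0) t) atTop (𝓝 0)) {ε : ℝ} (hε : 0 < ε) :
    Tendsto (fun n => distr (a n : L0) ε) atTop (𝓝 0) := by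
  have h1 := tendstoInMeasure_of_tendsto_ae (μ := (volume : Measure I))
    (f := fun n => (a n : L0)) (g := fun _ => (0 : ℝ))
    (fun n => (a n : L0).aestronglyMeasurable) h
  rw [tendstoInMeasure_iff_dist] at h1
  refine tendsto_of_tendsto_of_tendsto_of_le_of_le tendsto_const_nhds (h1 ε hε)
    (fun _ => zero_le) fun n => measure_mono fun t ht => ?_
  simpa using le_of_lt ht

/-- A sequence of independent copies of a function with mean zero is weakly null. -/
theorem weaklyNull_of_iid (hsep : TopologicalSpace.SeparableSpace E.carrier)
    (hF : E.FatouProperty) {u₁ : E.carrier} (hone : (u₁ : L0) =ᵐ[volume] fun _ => (1 : ℝ))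
    (g : E.carrier) (hg : ∫ t, (g : L0) t = 0) {U : ℕ → I → I}
    (hU : ∀ n, MeasurePreserving (U n) volume volume) (hind : iIndepFun U (volume : Measure I))
    (f : ℕ → E.carrier) (hf : ∀ n, (f n : L0) =ᵐ[volume] fun t => (g : L0) (U n t)) :
    E.WeaklyNull f := by
  -- The strong law gives a.e. convergence of the averages to the mean 0; the common law of the
  -- terms gives equi-absolute continuity, which upgrades this to norm convergence.
  have havg : ∀ φ : ℕ → ℕ, StrictMono φ →
      Tendsto (fun m : ℕ => (m : ℝ)⁻¹ • ∑ k ∈ Finset.range m, f (φ k)) atTop (𝓝 0) := by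
    intro φ hφ
    refine tendsto_norm_zero hone _ (fun ε hε => tendsto_distr_of_ae_tendsto _ ?_ hε) ?_
    · have := ae_tendsto_average g (hF.integrable hone g) (fun n => hU (φ n))
        (hind.precomp hφ.injective) (fun n => f (φ n)) fun n => hf (φ n)
      rwa [hg] at this
    · intro ε hε
      obtain ⟨δ, hδ, h⟩ := exists_norm_restrict_le_of_identDistrib hsep hF hone g hε
      refine ⟨δ, hδ, fun m A hA hvol => ?_⟩
      rw [map_smul, map_sum]
      refine norm_sum_div_le (fun k => restrict A hA (f (φ k))) hε.le (fun n => h _ ?_ A hA hvol) m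
      exact (IdentDistrib.of_ae_eq (AEEqFun.measurable _).aemeasurable (hf _)).trans
        (identDistrib_comp (g : L0).measurable (hU _))
  -- If `F (f n) ≥ ε` infinitely often, `F` is at least `ε` on the averages along those indices. The
  -- lower bound follows by using `-F`.
  have hnot : ∀ (F : StrongDual ℝ E.carrier) (ε : ℝ), 0 < ε → ∀ᶠ n in atTop, F (f n) < ε := by
    intro F ε hε
    by_contra hcon
    obtain ⟨φ, hφ, hφF⟩ := extraction_of_frequently_atTop (not_eventually.1 hcon)
    have h1 : Tendsto (fun m : ℕ => F ((m : ℝ)⁻¹ • ∑ k ∈ Finset.range m, f (φ k))) atTop (𝓝 0) := by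
      simpa [Function.comp_def] using (F.continuous.tendsto 0).comp (havg φ hφ)
    obtain ⟨m, hm, hm1⟩ := (((tendsto_order.1 h1).2 ε hε).and (eventually_ge_atTop 1)).exists
    refine absurd hm (not_lt.2 ?_)
    rw [map_smul, map_sum, smul_eq_mul, le_inv_mul_iff₀ (by exact_mod_cast hm1)]
    calc (m : ℝ) * ε = ∑ k ∈ Finset.range m, ε := by simp
      _ ≤ _ := Finset.sum_le_sum fun k _ => not_lt.1 (hφF k)
  intro F
  rw [tendsto_order]
  refine ⟨fun a ha => ?_, fun a ha => hnot F a ha⟩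
  filter_upwards [hnot (-F) (-a) (by linarith)] with n hn
  simpa using hn

/-! ### Bounded quantiles and identification of the constant -/

lemma norm_restrict_one_pos {u₁ : E.carrier} (hone : (u₁ : L0) =ᵐ[volume] fun _ => (1 : ℝ))
    {A : Set I} (hA : MeasurableSet A) (hpos : volume A ≠ 0) : 0 < ‖restrict A hA u₁‖ := by
  rw [norm_pos_iff]
  intro h
  refine hpos (measure_mono_null (t := {t : I | ¬ t ∉ A}) (fun t ht => not_not.2 ht) ?_)
  change ∀ᵐ t : I, t ∉ A
  filter_upwards [coeFn_restrict A hA u₁, hone, coeFn_zero (E := E)] with t h1 h2 h3 ht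
  rw [h, h3, Set.indicator_of_mem ht, h2] at h1
  exact zero_ne_one h1

/-- If `|x| ≥ b` on a set `A`, then `b ‖1_A‖ ≤ ‖x‖`. -/
lemma mul_norm_restrict_one_le {u₁ : E.carrier} (hone : (u₁ : L0) =ᵐ[volume] fun _ => (1 : ℝ))
    {A : Set I} (hA : MeasurableSet A) (x : E.carrier) {b : ℝ} (hb : 0 ≤ b)
    (h : ∀ᵐ t : I, t ∈ A → b ≤ |(x : L0) t|) : b * ‖restrict A hA u₁‖ ≤ ‖x‖ := by
  have h1 : ‖b • restrict A hA u₁‖ = b * ‖restrict A hA u₁‖ := by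
    rw [norm_smul, Real.norm_of_nonneg hb]
  rw [← h1]
  refine norm_le_of_abs_le _ _ ?_
  filter_upwards [coeFn_smul b (restrict A hA u₁), coeFn_restrict A hA u₁, hone, h]
    with t h1 h2 h3 h4
  rw [h1, h2]
  by_cases ht : t ∈ A
  · rw [Set.indicator_of_mem ht, h3, mul_one, abs_of_nonneg hb]
    exact h4 ht
  · simp [ht]

/-- The quantile functions of a norm bounded sequence are pointwise bounded. -/
lemma exists_abs_quantile_le {u₁ : E.carrier} (hone : (u₁ : L0) =ᵐ[volume] fun _ => (1 : ℝ))
    (ν : ℕ → Measure ℝ) (q : ℕ → E.carrier)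
    (hq : ∀ n, (q n : L0) =ᵐ[volume] fun t : I => quantile (ν n) t)
    {K : ℝ} (hK : ∀ n, ‖q n‖ ≤ K) (t : ℝ) (ht : t ∈ Set.Ioo (0 : ℝ) 1) :
    ∃ M, ∀ n, |quantile (ν n) t| ≤ M := by
  let τ : I := ⟨t, ht.1.le, ht.2.le⟩
  have hpos1 := norm_restrict_one_pos hone (A := Set.Ici τ) measurableSet_Ici (by
    rw [unitInterval.volume_Ici]
    simpa [← Subtype.coe_lt_coe, τ] using ht.2)
  have hpos2 := norm_restrict_one_pos hone (A := Set.Iic τ) measurableSet_Iic (by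
    rw [unitInterval.volume_Iic]
    simpa [← Subtype.coe_lt_coe, τ] using ht.1)
  refine ⟨max (K / ‖restrict (Set.Ici τ) measurableSet_Ici u₁‖)
    (K / ‖restrict (Set.Iic τ) measurableSet_Iic u₁‖), fun n => ?_⟩
  -- By monotonicity the absolute value at `t` is a lower bound for `|q n|` to the right of `t` if
  -- the quantile is nonnegative there, and to the left if it is nonpositive.
  rcases le_total 0 (quantile (ν n) t) with h0 | h0
  · refine le_max_of_le_left ((le_div_iff₀ hpos1).2 ?_)
    refine (mul_norm_restrict_one_le hone _ (q n) (abs_nonneg _) ?_).trans (hK n)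
    filter_upwards [hq n, ae_mem_Ioo] with s h1 hs hts
    rw [h1]
    exact abs_le_abs_of_nonneg h0 (quantile_monotoneOn _ ht hs hts)
  · refine le_max_of_le_right ((le_div_iff₀ hpos2).2 ?_)
    refine (mul_norm_restrict_one_le hone _ (q n) (abs_nonneg _) ?_).trans (hK n)
    filter_upwards [hq n, ae_mem_Ioo] with s h1 hs hts
    rw [h1]
    exact abs_le_abs_of_nonpos h0 (quantile_monotoneOn _ hs ht hts)

/-- If a sequence tending to zero in measure converges weakly to a constant, the constant is
zero. -/
lemma eq_zero_of_weaklyNull_add {u₁ : E.carrier}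
    (hone : (u₁ : L0) =ᵐ[volume] fun _ => (1 : ℝ)) {v : ℕ → E.carrier} {c : ℝ}
    (hv : E.WeaklyNull fun n => v n + c • u₁)
    (hv0 : ∀ ε : ℝ, 0 < ε → Tendsto (fun n => distr (v n : L0) ε) atTop (𝓝 0)) : c = 0 := by
  -- The bounds sum to 1/2, so a set of positive measure avoids every exceptional set. There `v ∘ ψ`
  -- tends to zero in norm, leaving a constant weakly null sequence.
  obtain ⟨ψ, hψ, hψv⟩ := extraction_forall_of_eventually (P := fun n k =>
    distr (v k : L0) ((1 / 2) ^ n) ≤ 2⁻¹ * 2⁻¹ ^ (n + 1)) fun n =>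
      ((tendsto_order.1 (hv0 _ (by positivity))).2 _
        (ENNReal.mul_pos (by simp) (pow_ne_zero _ (by simp)))).mono fun _ h => h.le
  let A : ℕ → Set I := fun n => {t : I | (1 / 2) ^ n < |(v (ψ n) : L0) t|}
  have hA : ∀ n, MeasurableSet (A n) := fun n => measurableSet_lt_abs _ _
  have hS : MeasurableSet (⋃ n, A n) := MeasurableSet.iUnion hA
  have hvol : volume (⋃ n, A n) ≤ 2⁻¹ := by
    calc volume (⋃ n, A n) ≤ ∑' n, volume (A n) := measure_iUnion_le _
      _ ≤ ∑' n : ℕ, 2⁻¹ * 2⁻¹ ^ (n + 1) := ENNReal.tsum_le_tsum hψv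
      _ = 2⁻¹ := by
        rw [ENNReal.tsum_mul_left, ENNReal.tsum_geometric_add_one]
        simp [ENNReal.inv_mul_cancel]
  have hcompl : volume (⋃ n, A n)ᶜ ≠ 0 := by
    rw [prob_compl_eq_one_sub hS]
    refine (tsub_pos_of_lt (hvol.trans_lt ?_)).ne'
    simp
  have hpos := norm_restrict_one_pos hone hS.compl hcompl
  have hsmall : Tendsto (fun n => restrict (⋃ n, A n)ᶜ hS.compl (v (ψ n))) atTop (𝓝 0) := by
    refine squeeze_zero_norm (a := fun n => (1 / 2 : ℝ) ^ n * ‖u₁‖) (fun n => ?_) ?_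
    · refine (norm_restrict_mono hS.compl (hA n).compl
        (Set.compl_subset_compl.2 (Set.subset_iUnion A n)) _).trans ?_
      exact norm_restrict_compl_le hone _ (by positivity) (hA n)
    · simpa using (tendsto_pow_atTop_nhds_zero_of_lt_one (r := (1 / 2 : ℝ)) (by norm_num)
        (by norm_num)).mul_const ‖u₁‖
  have h1 : E.WeaklyNull fun _ => c • restrict (⋃ n, A n)ᶜ hS.compl u₁ := by
    have h2 := ((hv.comp hψ).map (restrict (⋃ n, A n)ᶜ hS.compl)).sub
      (weaklyNull_of_tendsto hsmall)
    convert h2 using 2 with n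
    simp
  have h2 : c • restrict (⋃ n, A n)ᶜ hS.compl u₁ = 0 :=
    SeparatingDual.eq_zero_of_forall_dual_eq_zero (R := ℝ) fun F =>
      tendsto_nhds_unique tendsto_const_nhds (h1 F)
  exact (smul_eq_zero.1 h2).resolve_right (norm_pos_iff.1 hpos)

/-! ### From iid and disjoint to independent sequences -/

/-- If `Γ_iid(E)` is contained in `Γ_d(E)`, it is contained in `Γ_i(E)`. -/
theorem Γiid_subset_Γi (hsep : TopologicalSpace.SeparableSpace E.carrier)
    (hF : E.FatouProperty) (hsub : E.Γiid ⊆ E.Γd) : E.Γiid ⊆ E.Γi := by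
  intro p hp
  refine ⟨hp.1, fun x hx hxind => ?_⟩
  -- The zero space contains no nonzero constants and is treated apart.
  rcases subsingleton_or_nontrivial E.carrier with hE | hE
  · refine ⟨id, strictMono_id, isBSSeq_of_summable_norm hp.1 ?_⟩
    simp [Subsingleton.elim (_ : E.carrier) 0]
  obtain ⟨y₀, hy₀⟩ := exists_ne (0 : E.carrier)
  obtain ⟨u₁, hone⟩ := exists_one_mem hy₀
  have hxm : ∀ n, Measurable (x n : L0) := fun n => (x n : L0).measurable
  let ν : ℕ → Measure ℝ := fun n => (volume : Measure I).map (x n : L0)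
  have hν : ∀ n, IsProbabilityMeasure (ν n) := fun n =>
    Measure.isProbabilityMeasure_map (hxm n).aemeasurable
  have hquant : ∀ n, Measurable fun t : I => quantile (ν n) t := fun n => by fun_prop
  have hQid : ∀ n, IdentDistrib (fun t : I => quantile (ν n) t) (x n : L0)
      (volume : Measure I) volume := fun n =>
    ⟨(hquant n).aemeasurable, (hxm n).aemeasurable, map_quantile (ν n)⟩
  choose Q hQ hQn using fun n => exists_mem_of_identDistrib (x n) _ (hQid n)
  obtain ⟨K, hK⟩ := hx.bddAbove
  have hQK : ∀ n, ‖Q n‖ ≤ K := fun n => (hQn n).trans_le (hK ⟨n, rfl⟩)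
  obtain ⟨φ, hφ, G, hG⟩ := exists_subseq_tendsto_of_monotoneOn (fun n => quantile (ν n))
    (fun n => quantile_monotoneOn _) (exists_abs_quantile_le hone ν Q hQ hQK)
  have hGm : AEMeasurable (fun t : I => G t) (volume : Measure I) :=
    aemeasurable_of_tendsto_metrizable_ae atTop (fun n => (hquant (φ n)).aemeasurable) hG
  have hGc := AEEqFun.coeFn_mk _ hGm.aestronglyMeasurable
  have hQG : ∀ᵐ t : I, Tendsto (fun n => (Q (φ n) : L0) t) atTop
      (𝓝 ((AEEqFun.mk _ hGm.aestronglyMeasurable : L0) t)) := by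
    filter_upwards [hG, hGc, ae_all_iff.2 hQ] with t h1 h2 h3
    rw [h2]
    exact h1.congr fun n => (h3 _).symm
  obtain ⟨hqmem, -⟩ := hF.norm_le_of_forall_le (fun n => Q (φ n)) _ hQG fun n => hQK _
  set q : E.carrier := ⟨_, hqmem⟩
  obtain ⟨U, hU, hind⟩ := exists_iid_uniform
  have hmeas : ∀ z : E.carrier, Measurable (z : L0) := fun z => (z : L0).measurable
  choose y hy _ using fun n => exists_mem_of_identDistrib (Q (φ n))
    (fun t => (Q (φ n) : L0) (U n t)) (identDistrib_comp (hmeas _) (hU n))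
  -- `y` has the same joint distribution as the subsequence of `x`
  have hjoint : IdentDistrib (fun t n => (y n : L0) t) (fun t n => ((x ∘ φ) n : L0) t)
      (volume : Measure I) volume := by
    refine IdentDistrib.pi (fun n => ?_) ?_ (hxind.precomp hφ.injective)
    · exact (IdentDistrib.of_ae_eq (hmeas _).aemeasurable (hy n)).trans
        ((identDistrib_comp (hmeas _) (hU n)).trans
          ((IdentDistrib.of_ae_eq (hmeas _).aemeasurable (hQ (φ n))).trans (hQid (φ n))))
    · exact (hind.comp (fun n => (Q (φ n) : L0)) fun n => hmeas _).congr fun n => (hy n).symm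
  have hyW : E.WeaklyNull y := (hx.comp hφ).of_spanLE (spanLE_of_identDistrib hjoint)
  let c : ℝ := ∫ t, (q : L0) t
  -- Centring is needed for weak nullness of the iid copies; nothing is yet known about the mean of
  -- `q`.
  let g : E.carrier := q - c • u₁
  have hgc : (g : L0) =ᵐ[volume] fun t => (q : L0) t - c := by
    filter_upwards [coeFn_sub q (c • u₁), coeFn_smul c u₁, hone] with t h1 h2 h3
    rw [h1, h2, h3, mul_one]
  have hg0 : ∫ t, (g : L0) t = 0 := by
    rw [integral_congr_ae hgc, integral_sub (hF.integrable hone q) (integrable_const c)]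
    simp [c]
  choose f hf _ using fun n => exists_mem_of_identDistrib g
    (fun t => (g : L0) (U n t)) (identDistrib_comp (hmeas _) (hU n))
  have hfW : E.WeaklyNull f := weaklyNull_of_iid hsep hF hone g hg0 hU hind f hf
  have hfi : E.Independent f :=
    (hind.comp (fun _ => (g : L0)) fun _ => hmeas _).congr fun n => (hf n).symm
  have hfg : ∀ n, IdentDistrib (f n : L0) (g : L0) (volume : Measure I) volume := fun n =>
    (IdentDistrib.of_ae_eq (hmeas _).aemeasurable (hf n)).trans
      (identDistrib_comp (hmeas _) (hU n))
  obtain ⟨ψ, hψ, hfBS⟩ := hp.2 f hfW ⟨hfi, fun m n => (hfg m).trans (hfg n).symm⟩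
  -- As `y n` and `f n` are driven by the same `U n`, `v n` is `Q (φ n) - q` composed with `U n`,
  -- which tends to zero in measure.
  let v : ℕ → E.carrier := fun n => y n - f n - c • u₁
  have hv0 : ∀ ε : ℝ, 0 < ε → Tendsto (fun n => distr (v n : L0) ε) atTop (𝓝 0) := by
    intro ε hε
    have h1 : ∀ n, distr (v n : L0) ε = distr ((Q (φ n) - q : E.carrier) : L0) ε := fun n => by
      have h2 : (v n : L0) =ᵐ[volume] fun t => ((Q (φ n) - q : E.carrier) : L0) (U n t) := by
        filter_upwards [coeFn_sub (y n - f n) (c • u₁), coeFn_sub (y n) (f n), coeFn_smul c u₁,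
          hone, hy n, hf n, (hU n).quasiMeasurePreserving.ae hgc,
          (hU n).quasiMeasurePreserving.ae (coeFn_sub (Q (φ n)) q)] with t k1 k2 k3 k4 k5 k6 k7 k8
        rw [k1, k2, k3, k4, k5, k6, k7, k8]
        ring
      rw [distr_congr h2]
      exact distr_eq_of_identDistrib (identDistrib_comp (hmeas _) (hU n)) ε
    simp only [h1]
    refine tendsto_distr_of_ae_tendsto _ ?_ hε
    filter_upwards [hQG, ae_all_iff.2 fun n => coeFn_sub (Q (φ n)) q] with t k1 k2
    simp only [k2]
    rw [← sub_self ((q : L0) t)]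
    exact k1.sub_const ((q : L0) t)
  have hyf : E.WeaklyNull fun n => y n - f n := hyW.sub hfW
  -- Both `y` and `f` are weakly null, hence so is `v n + c • u₁`.
  have hc : c = 0 := eq_zero_of_weaklyNull_add hone (v := v) (c := c)
    (by simpa [v] using hyf) hv0
  have hvyf : v = fun n => y n - f n := by
    funext n
    simp [v, hc]
  obtain ⟨χ, hχ, hvBS⟩ := exists_isBSSeq_of_tendsto_distr hsep hF hone (hsub hp)
    (v := v ∘ ψ) ((hvyf ▸ hyf).comp hψ) fun ε hε => (hv0 ε hε).comp hψ.tendsto_atTop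
  have hyBS : E.IsBSSeq p (y ∘ ψ ∘ χ) := by
    have h1 := (hfBS.comp hχ).add hvBS
    convert h1 using 1
    funext n
    simp [hvyf]
  refine ⟨φ ∘ ψ ∘ χ, hφ.comp (hψ.comp hχ), hyBS.of_spanLE zero_le_one
    ((spanLE_of_identDistrib hjoint.symm).comp (ψ ∘ χ))⟩

lemma Γi_subset_Γiid : E.Γi ⊆ E.Γiid := fun _ hp => ⟨hp.1, fun x hx h => hp.2 x hx h.1⟩

end RISpace

theorem mainTheorem5 (E : RISpace) (hsep : TopologicalSpace.SeparableSpace E.carrier)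
    (hF : E.FatouProperty) :
    E.Γiid = E.Γi ↔ E.Γiid ⊆ E.Γd :=
  ⟨fun h => h ▸ RISpace.Γi_subset_Γd hsep hF,
    fun h => (RISpace.Γiid_subset_Γi hsep hF h).antisymm RISpace.Γi_subset_Γiid⟩

end
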